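/- Let $\mathfrak G\le \mathrm{GL}(2,\mathbb C)$ be the Shephard–Todd group $G_9$ (of order $192$), generated by $$T=\frac1{\sqrt2}\begin{pmatrix}1&1\\1&-1\end{pmatrix},\qquad D=\begin{pmatrix}1&0\\0&i\end{pmatrix}.$$ Let $\mathfrak R=\mathbb C[x,y]^{\mathfrak G}$ be its ring of invariants for the action $(\sigma\cdot f)(\mathbf x)=f(\sigma\mathbf x)$, $\mathbf x=(x,y)^{\mathsf T}$. For a representation $\rho:\mathfrak G\to\mathrm{GL}(m,\mathbb C)$ let $$M(\rho)=\{F\in\mathbb C[x,y]^m : F(\sigma\mathbf x)=\rho(\sigma)F(\mathbf x)\ \text{for all }\sigma\in\mathfrak G\},$$ a graded $\mathfrak R$-module, and let $M(\rho)_k$ be the space of those $F\in M(\rho)$ all of whose components are homogeneous of degree $k$. Put $$\Gamma=-x^5y+xy^5,\qquad \Delta=x^{12}-33x^8y^4-33x^4y^8+y^{12},\qquad \theta=x^8+14x^4y^4+y^8,$$ $$\varphi=x^{24}+759x^{16}y^8+2576x^{12}y^{12}+759x^8y^{16}+y^{24}.$$ Let $\rho_{21}$ be the three-dimensional irreducible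 representation on the span of $\alpha_1\otimes\alpha_1,\ \alpha_1\otimes\alpha_2+\alpha_2\otimes\alpha_1,\ \alpha_2\otimes\alpha_2$ inside $\mathbb C^2\otimes\mathbb C^2$ ($\alpha_1,\alpha_2$ the standard basis of the natural representation $\mathbb C^2$), so that $$\rho_{21}(T)=\frac12\begin{pmatrix}1&2&1\\1&0&-1\\1&-2&1\end{pmatrix},\qquad \rho_{21}(D)=\mathrm{diag}(1,i,-1).$$ For $k=1,\dots,8$ let $\rho_k$ be the linear character of $\mathfrak G$ with $\rho_k(T)=1,1,1,1,-1,-1,-1,-1$ and $\rho_k(D)=1,-1,i,-i,1,-1,i,-i$ respectively, and for $21\le i\le 28$ let $\rho_i=\rho_{i-20}\otimes\rho_{21}$. Let the numbers $d_i,c_i,e_i,k_i$ be given by $$\begin{array}{c|cccccccc} i&21&22&23&24&25&26&27&28\\\hline d_i&2&6&8&4&6&10&12&8\\ c_i&-2&4&-67&1600&-19228&2580&80&-894\\ e_i&1&1&1&1&2&2&2&2\\ k_i&3&5&6&4&3&5&6&4\end{array}$$ **Theorem.** Let $i\in\{21,\dots,28\}$. 1. $M(\rho_i)$ is a free $\mathfrak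 R$-module of rank $3$, and it has a homogeneous $\mathfrak R$-basis $\mathbf v^{(1)},\mathbf v^{(2)},\mathbf v^{(3)}$ of degrees $d_i,\ d_i+8,\ d_i+16$ (that is, all components of $\mathbf v^{(j)}$ are homogeneous of degree $d_i+8(j-1)$) which satisfies $$\det[\mathbf v^{(1)}\ \mathbf v^{(2)}\ \mathbf v^{(3)}]=c_i\,\Delta^{e_i}\,\Gamma^{k_i}.$$ 2. Every $M(\rho_i)_k$ is finite-dimensional over $\mathbb C$, and the Hilbert series of $M(\rho_i)$ is $$\sum_{k\ge0}\dim_{\mathbb C}M(\rho_i)_k\,t^k=\frac{t^{d_i}+t^{d_i+8}+t^{d_i+16}}{(1-t^8)(1-t^{24})}=t^{d_i}+2t^{d_i+8}+3t^{d_i+16}+4t^{d_i+24}+5t^{d_i+32}+\cdots.$$ 3. Every homogeneous $\mathfrak R$-basis $\mathbf v^{(1)},\mathbf v^{(2)},\mathbf v^{(3)}$ of $M(\rho_i)$ of degrees $d_i,d_i+8,d_i+16$ has the following properties. (a) For each $d$, the space $M(\rho_i)_d$ is spanned over $\mathbb C$ by the vectors $\theta^\alpha\varphi^\beta\mathbf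 v^{(j)}$ with $\alpha,\beta\ge0$ and $d=\deg\mathbf v^{(j)}+8\alpha+24\beta$. (b) $\det[\mathbf v^{(1)}\ \mathbf v^{(2)}\ \mathbf v^{(3)}]=c\,\Delta^{e_i}\,\Gamma^{k_i}$ for some $c\in\mathbb C^\times$; in particular the degree of this determinant is $\deg\mathbf v^{(1)}+\deg\mathbf v^{(2)}+\deg\mathbf v^{(3)}=12e_i+6k_i$. (c) If $i\in\{21,22,25,26\}$, then each $\mathbf v^{(j)}(x,y)=(f(x,y),\,g(x,y),\,f(y,x))^{\mathsf T}$ with $f,g$ homogeneous of degree $\deg\mathbf v^{(j)}$ and $g(y,x)=g(x,y)$. If $i\in\{23,24,27,28\}$, then each $\mathbf v^{(j)}(x,y)=(f(x,y),\,g(x,y),\,-f(y,x))^{\mathsf T}$ with $f,g$ homogeneous of degree $\deg\mathbf v^{(j)}$ and $g(y,x)=-g(x,y)$. -/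

import Mathlib

open MvPolynomial

namespace G9

noncomputable section

/-! ### The group -/

/-- The matrix `T = (1/√2) [[1, 1], [1, -1]]`. -/
def matT : Matrix (Fin 2) (Fin 2) ℂ :=
  ((Real.sqrt 2 : ℝ) : ℂ)⁻¹ • !![1, 1; 1, -1]

/-- The matrix `D = diag (1, i)`. -/
def matD : Matrix (Fin 2) (Fin 2) ℂ := !![1, 0; 0, Complex.I]

lemma sqrt_two_inv_sq : ((Real.sqrt 2 : ℝ) : ℂ)⁻¹ ^ 2 = 1 / 2 := by
  rw [inv_pow, ← Complex.ofReal_pow, Real.sq_sqrt (by norm_num)]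
  norm_num

lemma det_matT : matT.det = -1 := by
  have h := sqrt_two_inv_sq
  simp only [matT, Matrix.det_smul, Matrix.det_fin_two_of, Fintype.card_fin, h]
  norm_num

lemma det_matD : matD.det = Complex.I := by
  simp [matD, Matrix.det_fin_two_of]

/-- `T` as an element of `GL(2, ℂ)`. -/
def genT : GL (Fin 2) ℂ :=
  Matrix.GeneralLinearGroup.mkOfDetNeZero matT (by rw [det_matT]; norm_num)

/-- `D` as an element of `GL(2, ℂ)`. -/
def genD : GL (Fin 2) ℂ :=
  Matrix.GeneralLinearGroup.mkOfDetNeZero matD (by rw [det_matD]; exact Complex.I_ne_zero)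

@[simp] lemma coe_genT : (genT : Matrix (Fin 2) (Fin 2) ℂ) = matT := rfl

@[simp] lemma coe_genD : (genD : Matrix (Fin 2) (Fin 2) ℂ) = matD := rfl

/-- The Shephard-Todd group number 9, generated by `T` and `D`. -/
def grp : Subgroup (GL (Fin 2) ℂ) := Subgroup.closure {genT, genD}

lemma genT_mem : genT ∈ grp := Subgroup.subset_closure (by simp)

lemma genD_mem : genD ∈ grp := Subgroup.subset_closure (by simp)

/-- `T` as an element of the group. -/
def elT : grp := ⟨genT, genT_mem⟩

/-- `D` as an element of the group. -/
def elD : grp := ⟨genD, genD_mem⟩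

/-! ### Polynomials, invariants and covariants -/

/-- The polynomial ring `ℂ[x, y]`, with `x = X 0` and `y = X 1`. -/
abbrev Poly : Type := MvPolynomial (Fin 2) ℂ

/-- The substitution `f(𝐱) ↦ f(g 𝐱)`. -/
def act (g : Matrix (Fin 2) (Fin 2) ℂ) : Poly →ₐ[ℂ] Poly :=
  aeval fun i => ∑ j, C (g i j) * X j

/-- The invariant ring `ℜ = ℂ[x, y]^G`. -/
def invRing : Subalgebra ℂ Poly where
  carrier := {f | ∀ σ : grp, act ((σ : GL (Fin 2) ℂ) : Matrix (Fin 2) (Fin 2) ℂ) f = f}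
  mul_mem' := fun ha hb σ => by rw [map_mul, ha σ, hb σ]
  add_mem' := fun ha hb σ => by rw [map_add, ha σ, hb σ]
  algebraMap_mem' := fun r σ => AlgHom.commutes _ r

/-- The `ℜ`-module `M(ρ)` of covariants: the vectors `F ∈ ℂ[x, y]^m` with
`F(σ 𝐱) = ρ(σ) F(𝐱)` for all `σ` in the group. -/
def covModule {m : ℕ} (ρ : grp →* GL (Fin m) ℂ) : Submodule invRing (Fin m → Poly) where
  carrier := {F | ∀ σ : grp, ∀ r : Fin m,
    act ((σ : GL (Fin 2) ℂ) : Matrix (Fin 2) (Fin 2) ℂ) (F r) =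
      ∑ c, C ((ρ σ : Matrix (Fin m) (Fin m) ℂ) r c) * F c}
  zero_mem' := fun σ r => by simp
  add_mem' := fun {F H} hF hH σ r => by
    simp only [Pi.add_apply, map_add, hF σ r, hH σ r, mul_add, Finset.sum_add_distrib]
  smul_mem' := fun a F hF σ r => by
    have ha : act ((σ : GL (Fin 2) ℂ) : Matrix (Fin 2) (Fin 2) ℂ) (a : Poly) = a := a.2 σ
    simp only [Pi.smul_apply, Subalgebra.smul_def, smul_eq_mul, map_mul, ha, hF σ r,
      Finset.mul_sum]
    exact Finset.sum_congr rfl fun c _ => by ring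

/-- The `ℂ`-vector space `M(ρ)_k` of covariants all of whose components are homogeneous of
degree `k`. -/
def covDegree {m : ℕ} (ρ : grp →* GL (Fin m) ℂ) (k : ℕ) : Submodule ℂ (Fin m → Poly) where
  carrier := {F | F ∈ covModule ρ ∧ ∀ r, (F r).IsHomogeneous k}
  zero_mem' := ⟨Submodule.zero_mem _, fun _ => isHomogeneous_zero _ _ _⟩
  add_mem' := fun ha hb => ⟨Submodule.add_mem _ ha.1 hb.1, fun r => (ha.2 r).add (hb.2 r)⟩
  smul_mem' := fun c F hF => by
    refine ⟨?_, fun r => ?_⟩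
    · have h := Submodule.smul_mem (covModule ρ) (algebraMap ℂ invRing c) hF.1
      rwa [algebraMap_smul] at h
    · exact (homogeneousSubmodule (Fin 2) ℂ k).smul_mem c (hF.2 r)

/-- The Hilbert series `∑ₖ dim M(ρ)_k t^k`. -/
def hilbertSeries {m : ℕ} (ρ : grp →* GL (Fin m) ℂ) : PowerSeries ℤ :=
  PowerSeries.mk fun k => (Module.finrank ℂ (covDegree ρ k) : ℤ)

/-- `v` is an `ℜ`-basis of `M(ρ)`, and all components of `v j` are homogeneous of degree
`d j`. -/
structure IsHomogeneousBasis {m n : ℕ} (ρ : grp →* GL (Fin m) ℂ) (d : Fin n → ℕ)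
    (v : Fin n → Fin m → Poly) : Prop where
  linearIndependent : LinearIndependent invRing v
  span_eq : Submodule.span invRing (Set.range v) = covModule ρ
  homogeneous : ∀ j r, (v j r).IsHomogeneous (d j)

/-- The determinant of the matrix with columns `v 0, v 1, …`. -/
def colDet {m : ℕ} (v : Fin m → Fin m → Poly) : Poly :=
  (Matrix.of fun r j => v j r).det

/-- The involution `f(x, y) ↦ f(y, x)`. -/
def swapXY : Poly →ₐ[ℂ] Poly := rename (Equiv.swap 0 1)

/-- `Γ = -x⁵y + xy⁵`. -/
def polyGamma : Poly := -(X 0 ^ 5 * X 1) + X 0 * X 1 ^ 5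

/-- `Δ = x¹² - 33x⁸y⁴ - 33x⁴y⁸ + y¹²`. -/
def polyDelta : Poly :=
  X 0 ^ 12 - 33 * X 0 ^ 8 * X 1 ^ 4 - 33 * X 0 ^ 4 * X 1 ^ 8 + X 1 ^ 12

/-- `θ = x⁸ + 14x⁴y⁴ + y⁸`. -/
def polyTheta : Poly := X 0 ^ 8 + 14 * X 0 ^ 4 * X 1 ^ 4 + X 1 ^ 8

/-- `φ = x²⁴ + 759x¹⁶y⁸ + 2576x¹²y¹² + 759x⁸y¹⁶ + y²⁴`. -/
def polyPhi : Poly :=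
  X 0 ^ 24 + 759 * X 0 ^ 16 * X 1 ^ 8 + 2576 * X 0 ^ 12 * X 1 ^ 12
    + 759 * X 0 ^ 8 * X 1 ^ 16 + X 1 ^ 24

/-! ### The one-dimensional representations -/

/-- The value `Δ(a, b)`. -/
def deltaVal (a b : ℂ) : ℂ := a ^ 12 - 33 * a ^ 8 * b ^ 4 - 33 * a ^ 4 * b ^ 8 + b ^ 12

/-- `Δ` evaluated at the first column of `g`. On the group, `Δ(g 𝐱) = epsVal g * Δ(𝐱)`. -/
def epsVal (g : Matrix (Fin 2) (Fin 2) ℂ) : ℂ := deltaVal (g 0 0) (g 1 0)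

lemma deltaVal_act (σ : GL (Fin 2) ℂ) (hσ : σ ∈ grp) : ∀ a b : ℂ,
    deltaVal (σ 0 0 * a + σ 0 1 * b) (σ 1 0 * a + σ 1 1 * b) = epsVal σ * deltaVal a b := by
  induction hσ using Subgroup.closure_induction with
  | mem g hg =>
    intro a b
    rcases hg with rfl | rfl
    · simp only [coe_genT, epsVal, deltaVal, matT, Matrix.smul_apply, Matrix.of_apply,
        Matrix.cons_val', Matrix.cons_val_zero, Matrix.cons_val_one, Matrix.cons_val_fin_one,
        smul_eq_mul]
      ring
    · have h : Complex.I ^ 4 = 1 := Complex.I_pow_four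
      simp only [coe_genD, epsVal, deltaVal, matD, Matrix.of_apply,
        Matrix.cons_val', Matrix.cons_val_zero, Matrix.cons_val_one, Matrix.cons_val_fin_one]
      generalize Complex.I = u at h
      have h8 : u ^ 8 = 1 := by rw [show 8 = 4 * 2 from rfl, pow_mul, h, one_pow]
      have h12 : u ^ 12 = 1 := by rw [show 12 = 4 * 3 from rfl, pow_mul, h, one_pow]
      ring_nf
      simp only [h, h8, h12]
      ring
  | one => intro a b; simp [epsVal, deltaVal]
  | mul g h _ _ ihg ihh =>
    intro a b
    have e1 : epsVal ((g * h : GL (Fin 2) ℂ) : Matrix (Fin 2) (Fin 2) ℂ)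
        = epsVal g * epsVal h := by
      have := ihg (h 0 0) (h 1 0)
      simpa [epsVal, Matrix.mul_apply, Fin.sum_univ_two] using this
    rw [e1, mul_assoc, ← ihh a b, ← ihg]
    simp only [Units.val_mul, Matrix.mul_apply, Fin.sum_univ_two]
    congr 1 <;> ring
  | inv g _ ih =>
    have hm : (g : Matrix (Fin 2) (Fin 2) ℂ) * ((g⁻¹ : GL (Fin 2) ℂ) : Matrix (Fin 2) (Fin 2) ℂ)
        = 1 := by rw [← Units.val_mul, mul_inv_cancel, Units.val_one]
    have h00 := congrFun (congrFun hm 0) 0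
    have h01 := congrFun (congrFun hm 0) 1
    have h10 := congrFun (congrFun hm 1) 0
    have h11 := congrFun (congrFun hm 1) 1
    simp only [Matrix.mul_apply, Fin.sum_univ_two, Matrix.one_apply_eq, Matrix.one_apply,
      zero_ne_one, one_ne_zero, if_false] at h00 h01 h10 h11
    generalize ((g⁻¹ : GL (Fin 2) ℂ) : Matrix (Fin 2) (Fin 2) ℂ) = k at *
    have key : ∀ a b : ℂ, deltaVal a b
        = epsVal g * deltaVal (k 0 0 * a + k 0 1 * b) (k 1 0 * a + k 1 1 * b) := by
      intro a b
      rw [← ih]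
      congr 1
      · linear_combination (-a) * h00 - b * h01
      · linear_combination (-a) * h10 - b * h11
    have k1 : epsVal g * epsVal k = 1 := by
      have := key 1 0
      simp only [mul_one, mul_zero, add_zero] at this
      rw [epsVal, epsVal] at *
      rw [← this]
      simp [deltaVal]
    intro a b
    have := key a b
    rw [this, ← mul_assoc, mul_comm (epsVal k), k1, one_mul]

/-- The linear character `ε` of the group with `Δ(σ 𝐱) = ε(σ) Δ(𝐱)`; it satisfies `ε(T) = -1`,
`ε(D) = 1`. -/
def epsChar : grp →* ℂˣ :=
  MonoidHom.toHomUnits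
    { toFun := fun σ => epsVal ((σ : GL (Fin 2) ℂ) : Matrix (Fin 2) (Fin 2) ℂ)
      map_one' := by simp [epsVal, deltaVal]
      map_mul' := fun σ τ => by
        have := deltaVal_act σ σ.2 ((τ : GL (Fin 2) ℂ) 0 0) ((τ : GL (Fin 2) ℂ) 1 0)
        simpa [epsVal, Matrix.mul_apply, Fin.sum_univ_two] using this }

/-- The determinant character of the group; `det T = -1`, `det D = i`. -/
def detChar : grp →* ℂˣ := Matrix.GeneralLinearGroup.det.comp grp.subtype

/-- The eight one-dimensional representations `ρ₁, …, ρ₈`; see `linRep_elT`, `linRep_elD` for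
their values at the generators. -/
def linRep : ℕ → (grp →* ℂˣ)
  | 1 => 1
  | 2 => (epsChar * detChar) ^ 2
  | 3 => epsChar * detChar
  | 4 => (epsChar * detChar) ^ 3
  | 5 => epsChar
  | 6 => epsChar * (epsChar * detChar) ^ 2
  | 7 => epsChar * (epsChar * detChar)
  | 8 => epsChar * (epsChar * detChar) ^ 3
  | _ => 1

lemma epsChar_elT : (epsChar elT : ℂ) = -1 := by
  have h := sqrt_two_inv_sq
  have h12 : ((Real.sqrt 2 : ℝ) : ℂ)⁻¹ ^ 12 = 1 / 64 := by
    rw [show 12 = 2 * 6 from rfl, pow_mul, h]; norm_num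
  change epsVal matT = -1
  simp only [epsVal, deltaVal, matT, Matrix.smul_apply, Matrix.of_apply,
    Matrix.cons_val', Matrix.cons_val_zero, Matrix.cons_val_one, Matrix.cons_val_fin_one,
    smul_eq_mul]
  linear_combination (-64) * h12

lemma epsChar_elD : (epsChar elD : ℂ) = 1 := by
  change epsVal matD = 1
  simp [epsVal, deltaVal, matD]

lemma detChar_elT : (detChar elT : ℂ) = -1 := det_matT

lemma detChar_elD : (detChar elD : ℂ) = Complex.I := det_matD

lemma linRep_elT : (linRep 1 elT : ℂ) = 1 ∧ (linRep 2 elT : ℂ) = 1 ∧ (linRep 3 elT : ℂ) = 1 ∧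
    (linRep 4 elT : ℂ) = 1 ∧ (linRep 5 elT : ℂ) = -1 ∧ (linRep 6 elT : ℂ) = -1 ∧
    (linRep 7 elT : ℂ) = -1 ∧ (linRep 8 elT : ℂ) = -1 := by
  simp [linRep, epsChar_elT, detChar_elT]

lemma linRep_elD : (linRep 1 elD : ℂ) = 1 ∧ (linRep 2 elD : ℂ) = -1 ∧
    (linRep 3 elD : ℂ) = Complex.I ∧ (linRep 4 elD : ℂ) = -Complex.I ∧
    (linRep 5 elD : ℂ) = 1 ∧ (linRep 6 elD : ℂ) = -1 ∧
    (linRep 7 elD : ℂ) = Complex.I ∧ (linRep 8 elD : ℂ) = -Complex.I := by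
  simp [linRep, epsChar_elD, detChar_elD]

/-! ### The three-dimensional representations -/

/-- The matrix by which `g` acts on the span of `α₁' = α₁ ⊗ α₁`, `α₂' = α₁ ⊗ α₂ + α₂ ⊗ α₁`,
`α₃' = α₂ ⊗ α₂` inside the tensor square of the natural representation; the columns are the
images of the basis vectors. -/
def symSq (g : Matrix (Fin 2) (Fin 2) ℂ) : Matrix (Fin 3) (Fin 3) ℂ :=
  !![g 0 0 ^ 2,       2 * (g 0 0 * g 0 1),               g 0 1 ^ 2;
     g 0 0 * g 1 0,   g 0 0 * g 1 1 + g 0 1 * g 1 0,     g 0 1 * g 1 1;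
     g 1 0 ^ 2,       2 * (g 1 0 * g 1 1),               g 1 1 ^ 2]

lemma symSq_one : symSq 1 = 1 := by
  ext i j
  fin_cases i <;> fin_cases j <;> simp [symSq]

lemma symSq_mul (g h : Matrix (Fin 2) (Fin 2) ℂ) : symSq (g * h) = symSq g * symSq h := by
  ext i j
  fin_cases i <;> fin_cases j <;>
    simp [symSq, Matrix.mul_apply, Fin.sum_univ_two, Fin.sum_univ_three] <;> ring

/-- The representation `ρ₂₁`. -/
def rho21 : grp →* GL (Fin 3) ℂ :=
  MonoidHom.toHomUnits
    { toFun := fun σ => symSq ((σ : GL (Fin 2) ℂ) : Matrix (Fin 2) (Fin 2) ℂ)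
      map_one' := by simpa using symSq_one
      map_mul' := fun σ τ => by simpa using symSq_mul _ _ }

lemma rho21_elT : (rho21 elT : Matrix (Fin 3) (Fin 3) ℂ)
    = (1 / 2 : ℂ) • !![1, 2, 1; 1, 0, -1; 1, -2, 1] := by
  have h := sqrt_two_inv_sq
  change symSq matT = _
  rw [← h]
  ext i j
  fin_cases i <;> fin_cases j <;> simp [symSq, matT] <;> ring

lemma rho21_elD : (rho21 elD : Matrix (Fin 3) (Fin 3) ℂ)
    = Matrix.diagonal ![1, Complex.I, -1] := by
  change symSq matD = _
  ext i j
  fin_cases i <;> fin_cases j <;> simp [symSq, matD]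

/-- The twist `χ ⊗ ρ` of a representation by a linear character. -/
def twist {m : ℕ} (χ : grp →* ℂˣ) (ρ : grp →* GL (Fin m) ℂ) : grp →* GL (Fin m) ℂ :=
  MonoidHom.toHomUnits
    { toFun := fun σ => (χ σ : ℂ) • (ρ σ : Matrix (Fin m) (Fin m) ℂ)
      map_one' := by simp
      map_mul' := fun σ τ => by
        simp only [map_mul, Units.val_mul, Matrix.smul_mul, Matrix.mul_smul, smul_smul]
        rw [mul_comm] }

/-- The three-dimensional representations: `ρᵢ = ρ_{i-20} ⊗ ρ₂₁` for `21 ≤ i ≤ 28`. -/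
def rho (i : ℕ) : grp →* GL (Fin 3) ℂ := twist (linRep (i - 20)) rho21

/-! ### The numerical data -/

/-- The lowest degrees `dᵢ`. -/
def degTable : ℕ → ℕ
  | 21 => 2
  | 22 => 6
  | 23 => 8
  | 24 => 4
  | 25 => 6
  | 26 => 10
  | 27 => 12
  | 28 => 8
  | _ => 0

/-- The constants `cᵢ`. -/
def cTable : ℕ → ℂ
  | 21 => -2
  | 22 => 4
  | 23 => -67
  | 24 => 1600
  | 25 => -19228
  | 26 => 2580
  | 27 => 80
  | 28 => -894
  | _ => 0

/-- The exponents `eᵢ` of `Δ`. -/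
def eTable : ℕ → ℕ
  | 21 => 1
  | 22 => 1
  | 23 => 1
  | 24 => 1
  | 25 => 2
  | 26 => 2
  | 27 => 2
  | 28 => 2
  | _ => 0

/-- The exponents `kᵢ` of `Γ`. -/
def kTable : ℕ → ℕ
  | 21 => 3
  | 22 => 5
  | 23 => 6
  | 24 => 4
  | 25 => 3
  | 26 => 5
  | 27 => 6
  | 28 => 4
  | _ => 0

/-- The degrees `dᵢ, dᵢ + 8, dᵢ + 16`. -/
def genDegree (i : ℕ) (j : Fin 3) : ℕ := degTable i + 8 * (j : ℕ)

end

end G9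

open MvPolynomial

namespace G9

noncomputable section

/-! ### Substitutions -/

/-! The determinant of three covariants in M(ρ_i) is a semi-invariant with character det ρ_i, and
its vanishing on the reflecting lines is forced. The reflection D fixes y = 0 pointwise and acts
diagonally with eigenvalues iⁿ, iⁿ⁺¹, -iⁿ, so the rows are divisible by powers of y with exponents
n, n+1, n+2 reduced modulo 4; their sum is k_i. The reflection T fixes x = (1+√2)y pointwise, and
the (-1)-eigenspace of ρ_i(T) has dimension e_i, which yields e_i factors x - (1+√2)y.
Semi-invariance spreads the vanishing over the orbits of the two lines, which are the six linear
factors of Γ and the twelve of Δ. So Δ^{e_i} Γ^{k_i} divides every such determinant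
(`polyDelta_mul_polyGamma_dvd_colDet`).

Conversely, covariants whose determinant is a nonzero multiple of this product form a basis, because
Cramer's rule then has polynomial, invariant coefficients (`mem_span_of_cramer`). Such triples are
explicit (`exists_homCov_colDet_eq`). For a semi-invariant f with character χ, the rotated gradient
is covariant for χ det⁻¹ ⊗ ℂ², and the rotated Hessian for χ det⁻² ⊗ ρ₂₁. Hessians, and symmetric
products of gradients with each other or with (x, y), therefore lie in twists of ρ₂₁; factors Γ and
Δ adjust twist, degree and determinant.

For the Hilbert series, the group contains a scalar of order 8, so invariants live in degrees 8n.
Subtracting a multiple of θⁿ makes an invariant vanish on y = 0, and it is then divisible by Γ⁴.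
With φ = θ³ - 42Γ⁴ this gives generation by θ and φ, and all dimensions by recursion. The symmetry
under x ↔ y holds because the swap is T D² T, an element of the group. -/

lemma act_act (g h : Matrix (Fin 2) (Fin 2) ℂ) (f : Poly) : act g (act h f) = act (h * g) f := by
  have : (act g).comp (act h) = act (h * g) := by
    refine algHom_ext fun i => ?_
    simp [act, Matrix.mul_apply]
    ring
  exact DFunLike.congr_fun this f

lemma act_one (f : Poly) : act 1 f = f := by
  have : act 1 = AlgHom.id ℂ Poly := by
    ext i
    fin_cases i <;> simp [act]
  rw [this]; rfl

lemma act_C (g : Matrix (Fin 2) (Fin 2) ℂ) (c : ℂ) : act g (C c) = C c :=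
  (act g).commutes c

lemma act_matT_X0 : act matT (X 0) = C ((Real.sqrt 2 : ℝ) : ℂ)⁻¹ * (X 0 + X 1) := by
  simp [act, matT, mul_add]

lemma act_matT_X1 : act matT (X 1) = C ((Real.sqrt 2 : ℝ) : ℂ)⁻¹ * (X 0 - X 1) := by
  simp [act, matT]
  ring

lemma act_matD_X0 : act matD (X 0) = X 0 := by
  simp [act, matD]

lemma act_matD_X1 : act matD (X 1) = C Complex.I * X 1 := by
  simp [act, matD]

lemma two_mul_sqrt_two_inv_sq : (2 : Poly) * C ((Real.sqrt 2 : ℝ) : ℂ)⁻¹ ^ 2 = 1 := by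
  rw [← map_pow, sqrt_two_inv_sq, show (2 : Poly) = C 2 from (map_ofNat C 2).symm, ← map_mul]
  norm_num

lemma C_I_sq : (C Complex.I : Poly) ^ 2 = -1 := by
  rw [← map_pow, Complex.I_sq]; simp

lemma isHomogeneous_act (g : Matrix (Fin 2) (Fin 2) ℂ) {f : Poly} {n : ℕ}
    (hf : f.IsHomogeneous n) : (act g f).IsHomogeneous n := by
  have := hf.aeval (fun i => ∑ j, C (g i j) * X j : Fin 2 → Poly) (n := 1)
    fun i => IsHomogeneous.sum _ _ _ fun j _ => isHomogeneous_C_mul_X _ _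
  simpa [act] using this

lemma homogeneousComponent_act (g : Matrix (Fin 2) (Fin 2) ℂ) (n : ℕ) (f : Poly) :
    homogeneousComponent n (act g f) = act g (homogeneousComponent n f) := by
  conv_lhs => rw [← sum_homogeneousComponent f, map_sum, map_sum]
  have h : ∀ m ∈ Finset.range (f.totalDegree + 1),
      homogeneousComponent n (act g (homogeneousComponent m f)) =
        if m = n then act g (homogeneousComponent m f) else 0 := fun m _ => by
    rw [homogeneousComponent_of_mem
      (isHomogeneous_act g (homogeneousComponent_isHomogeneous m f))]
    simp only [eq_comm]
  rw [Finset.sum_congr rfl h, Finset.sum_ite_eq']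
  split_ifs with hn
  · rfl
  · rw [homogeneousComponent_eq_zero n f (by simpa using hn), map_zero]

/-! ### Generation of the group by `T` and `D` -/

lemma closure_elT_elD : Subgroup.closure ({elT, elD} : Set grp) = ⊤ := by
  have key : Subgroup.closure
      ((fun σ : grp => (σ : GL (Fin 2) ℂ)) ⁻¹' ({genT, genD} : Set (GL (Fin 2) ℂ))) = ⊤ :=
    Subgroup.closure_closure_coe_preimage
  rw [← key]
  congr 1
  ext ⟨g, hg⟩
  simp [elT, elD, Subtype.ext_iff]

/-- A family `F` of polynomials satisfies the covariance condition at `σ`. -/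
def CovAt {m : ℕ} (ρ : grp →* GL (Fin m) ℂ) (F : Fin m → Poly) (σ : grp) : Prop :=
  ∀ r, act ((σ : GL (Fin 2) ℂ) : Matrix (Fin 2) (Fin 2) ℂ) (F r) =
    ∑ c, C ((ρ σ : Matrix (Fin m) (Fin m) ℂ) r c) * F c

lemma CovAt.mul {m : ℕ} {ρ : grp →* GL (Fin m) ℂ} {F : Fin m → Poly} {σ τ : grp}
    (hσ : CovAt ρ F σ) (hτ : CovAt ρ F τ) : CovAt ρ F (σ * τ) := fun r => by
  rw [Subgroup.coe_mul, Units.val_mul, ← act_act, hσ r, map_sum]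
  simp only [map_mul, act_C, hτ _, Units.val_mul, Matrix.mul_apply, map_sum, Finset.mul_sum,
    Finset.sum_mul, mul_assoc]
  exact Finset.sum_comm

/-- Substituting σ⁻¹ into the relation at σ expresses F through ρ(σ) and the transformed F;
multiplying by ρ(σ⁻¹) solves for the latter. -/
lemma CovAt.inv {m : ℕ} {ρ : grp →* GL (Fin m) ℂ} {F : Fin m → Poly} {σ : grp}
    (hσ : CovAt ρ F σ) : CovAt ρ F σ⁻¹ := fun r => by
  have h1 : ∀ c, F c = ∑ d, C ((ρ σ : Matrix (Fin m) (Fin m) ℂ) c d) *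
      act (((σ⁻¹ : grp) : GL (Fin 2) ℂ) : Matrix (Fin 2) (Fin 2) ℂ) (F d) := fun c => by
    have := congrArg (act (((σ⁻¹ : grp) : GL (Fin 2) ℂ) : Matrix (Fin 2) (Fin 2) ℂ)) (hσ c)
    rw [act_act, ← Units.val_mul, ← Subgroup.coe_mul, mul_inv_cancel, Subgroup.coe_one,
      Units.val_one, act_one, map_sum] at this
    simpa only [map_mul, act_C] using this
  have h2 : ((ρ σ⁻¹ : GL (Fin m) ℂ) : Matrix (Fin m) (Fin m) ℂ) * (ρ σ : Matrix _ _ ℂ) = 1 := by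
    rw [← Units.val_mul, ← map_mul, inv_mul_cancel, map_one, Units.val_one]
  calc _ = ∑ d, C ((1 : Matrix (Fin m) (Fin m) ℂ) r d) *
        act (((σ⁻¹ : grp) : GL (Fin 2) ℂ) : Matrix (Fin 2) (Fin 2) ℂ) (F d) := by
        simp [Matrix.one_apply, apply_ite C]
    _ = _ := by
        rw [← h2]
        conv_rhs => enter [2, c]; rw [h1 c]
        simp only [Matrix.mul_apply, map_sum, map_mul, Finset.mul_sum, Finset.sum_mul, mul_assoc]
        exact Finset.sum_comm

lemma CovAt.one {m : ℕ} (ρ : grp →* GL (Fin m) ℂ) (F : Fin m → Poly) : CovAt ρ F 1 := fun r => by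
  simp [act_one, Matrix.one_apply, apply_ite C]

/-- The elements satisfying the covariance condition form a subgroup, so the generators suffice. -/
lemma mem_covModule_iff {m : ℕ} (ρ : grp →* GL (Fin m) ℂ) (F : Fin m → Poly) :
    F ∈ covModule ρ ↔ CovAt ρ F elT ∧ CovAt ρ F elD := by
  refine ⟨fun h => ⟨h elT, h elD⟩, fun ⟨hT, hD⟩ σ => ?_⟩
  have hσ : σ ∈ Subgroup.closure ({elT, elD} : Set grp) := by simp [closure_elT_elD]
  change CovAt ρ F σ
  induction hσ using Subgroup.closure_induction with
  | mem g hg =>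
    rcases hg with h | h
    · rw [h]; exact hT
    · rw [Set.mem_singleton_iff.1 h]; exact hD
  | one => exact .one ρ F
  | mul g h _ _ ihg ihh => exact ihg.mul ihh
  | inv g _ ih => exact ih.inv

/-! ### Semi-invariants -/

/-- `f` is multiplied by `a` under `T` and by `b` under `D`. -/
def IsSemi (a b : ℂ) (f : Poly) : Prop := act matT f = C a * f ∧ act matD f = C b * f

lemma IsSemi.mul {a b a' b' : ℂ} {f g : Poly} (hf : IsSemi a b f) (hg : IsSemi a' b' g) :
    IsSemi (a * a') (b * b') (f * g) := by
  constructor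
  · rw [map_mul, hf.1, hg.1, C_mul]; ring
  · rw [map_mul, hf.2, hg.2, C_mul]; ring

lemma IsSemi.pow {a b : ℂ} {f : Poly} (hf : IsSemi a b f) (n : ℕ) :
    IsSemi (a ^ n) (b ^ n) (f ^ n) := by
  constructor
  · rw [map_pow, hf.1, mul_pow, C_pow]
  · rw [map_pow, hf.2, mul_pow, C_pow]

lemma IsSemi.of_mul {a b a' b' : ℂ} {f g : Poly} (hf : IsSemi a b f) (ha : a ≠ 0) (hb : b ≠ 0)
    (hf0 : f ≠ 0) (hfg : IsSemi (a * a') (b * b') (f * g)) : IsSemi a' b' g := by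
  constructor
  · refine mul_left_cancel₀ (mul_ne_zero (C_ne_zero.2 ha) hf0) ?_
    have := hfg.1
    rw [map_mul, hf.1, C_mul] at this
    rw [this]; ring
  · refine mul_left_cancel₀ (mul_ne_zero (C_ne_zero.2 hb) hf0) ?_
    have := hfg.2
    rw [map_mul, hf.2, C_mul] at this
    rw [this]; ring

/-- Invariants are the covariants of the trivial one-dimensional representation, so the reduction to
generators applies. -/
lemma mem_invRing_iff {f : Poly} : f ∈ invRing ↔ IsSemi 1 1 f := by
  have h := mem_covModule_iff (m := 1) 1 (fun _ => f)
  constructor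
  · intro hf
    refine ⟨?_, ?_⟩
    · rw [C_1, one_mul]; exact hf elT
    · rw [C_1, one_mul]; exact hf elD
  · intro hf σ
    have hT := hf.1
    have hD := hf.2
    rw [C_1, one_mul] at hT hD
    have := h.2 ⟨fun r => ?_, fun r => ?_⟩ σ 0
    · simpa using this
    · rw [Subsingleton.elim r 0]
      exact hT.trans (by simp)
    · rw [Subsingleton.elim r 0]
      exact hD.trans (by simp)

lemma polyTheta_isSemi : IsSemi 1 1 polyTheta := by
  have h2 := two_mul_sqrt_two_inv_sq
  -- With u = 2s² and s = 1/√2, this is u⁴ - 1 = (u³ + u² + u + 1)(u - 1).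
  have h16 : (16 : Poly) * C ((Real.sqrt 2 : ℝ) : ℂ)⁻¹ ^ 8 = 1 := by
    linear_combination (8 * C ((Real.sqrt 2 : ℝ) : ℂ)⁻¹ ^ 6 + 4 * C ((Real.sqrt 2 : ℝ) : ℂ)⁻¹ ^ 4 +
      2 * C ((Real.sqrt 2 : ℝ) : ℂ)⁻¹ ^ 2 + 1 : Poly) * h2
  have h4 : (C Complex.I : Poly) ^ 4 = 1 := by
    linear_combination (C Complex.I ^ 2 - 1 : Poly) * C_I_sq
  constructor
  · simp only [polyTheta, map_add, map_mul, map_pow, map_ofNat, act_matT_X0, act_matT_X1, C_1]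
    linear_combination (X 0 ^ 8 + 14 * X 0 ^ 4 * X 1 ^ 4 + X 1 ^ 8 : Poly) * h16
  · simp only [polyTheta, map_add, map_mul, map_pow, map_ofNat, act_matD_X0, act_matD_X1, C_1]
    linear_combination (14 * X 0 ^ 4 * X 1 ^ 4 + X 1 ^ 8 * (C Complex.I ^ 4 + 1) : Poly) * h4

/-! ### Divisibility by linear forms -/

/-- The linear form `x - a y`. -/
def lineForm (a : ℂ) : Poly := X 0 - C a * X 1

/-- The binary form `x⁴ - c y⁴`. -/
def quarticForm (c : ℂ) : Poly := X 0 ^ 4 - C c * X 1 ^ 4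

/-- Restriction to the line `y = 0`. -/
def restrictAxis : Poly →ₐ[ℂ] Poly := aeval ![X 0, 0]

/-- Restriction to the line `x = a y`. -/
def restrictLine (a : ℂ) : Poly →ₐ[ℂ] Poly := aeval ![C a * X 1, X 1]

/-- Modulo l the endomorphism s agrees with the identity on the variables, hence everywhere. Taking
s to be the restriction to the line l = 0 gives the factor theorem for l. -/
lemma dvd_sub_of_dvd_X_sub {l : Poly} (s : Poly →ₐ[ℂ] Poly) (h : ∀ i, l ∣ X i - s (X i))
    (f : Poly) : l ∣ f - s f := by
  induction f using MvPolynomial.induction_on with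
  | C a => rw [show s (C a) = C a from s.commutes a, sub_self]; exact dvd_zero _
  | add p q hp hq =>
    rw [map_add, add_sub_add_comm]
    exact dvd_add hp hq
  | mul_X p i hp =>
    rw [map_mul, show p * X i - s p * s (X i) = (p - s p) * X i + s p * (X i - s (X i)) by ring]
    exact dvd_add (hp.mul_right _) ((h i).mul_left _)

lemma X_one_dvd_sub_restrictAxis (f : Poly) : X 1 ∣ f - restrictAxis f :=
  dvd_sub_of_dvd_X_sub restrictAxis (fun i => by fin_cases i <;> simp [restrictAxis]) f

lemma X_one_dvd_of_restrictAxis_eq_zero {f : Poly} (h : restrictAxis f = 0) : X 1 ∣ f := by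
  simpa [h] using X_one_dvd_sub_restrictAxis f

lemma lineForm_dvd_of_restrictLine_eq_zero {a : ℂ} {f : Poly} (h : restrictLine a f = 0) :
    lineForm a ∣ f := by
  have := dvd_sub_of_dvd_X_sub (l := lineForm a) (restrictLine a)
    (fun i => by fin_cases i <;> simp [restrictLine, lineForm]) f
  simpa [h] using this

lemma restrictAxis_act_matD (f : Poly) : restrictAxis (act matD f) = restrictAxis f := by
  have : restrictAxis.comp (act matD) = restrictAxis := by
    refine algHom_ext fun i => ?_
    fin_cases i
    · simp [act_matD_X0]
    · simp [act_matD_X1, restrictAxis]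
  exact DFunLike.congr_fun this f

lemma ofReal_sqrt_two_sq : ((Real.sqrt 2 : ℝ) : ℂ) ^ 2 = 2 := by
  rw [← Complex.ofReal_pow, Real.sq_sqrt (by norm_num)]
  norm_num

lemma ofReal_sqrt_two_ne_zero : ((Real.sqrt 2 : ℝ) : ℂ) ≠ 0 := fun h => by
  simpa [h] using ofReal_sqrt_two_sq

/-- The vector (1+√2, 1) is fixed by T, so T acts trivially on the line it spans. -/
lemma restrictLine_act_matT (f : Poly) :
    restrictLine (1 + (Real.sqrt 2 : ℝ)) (act matT f) = restrictLine (1 + (Real.sqrt 2 : ℝ)) f := by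
  have h2 := ofReal_sqrt_two_sq
  have h0 := ofReal_sqrt_two_ne_zero
  have hT0 := act_matT_X0
  have hT1 := act_matT_X1
  have : (restrictLine (1 + (Real.sqrt 2 : ℝ))).comp (act matT)
      = restrictLine (1 + (Real.sqrt 2 : ℝ)) := by
    refine algHom_ext fun i => ?_
    generalize ((Real.sqrt 2 : ℝ) : ℂ) = r at *
    fin_cases i
    · have : (C r⁻¹ * (C (1 + r) + 1) : Poly) = C (1 + r) := by
        rw [← C_1, ← map_add, ← map_mul]
        congr 1
        field_simp
        linear_combination -h2
      simp only [Fin.zero_eta, AlgHom.comp_apply, hT0, restrictLine, map_mul,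
        aeval_X, Matrix.cons_val_zero]
      rw [show (aeval ![C (1 + r) * X 1, (X 1 : Poly)]) (C r⁻¹ : Poly) = (C r⁻¹ : Poly) from
        AlgHom.commutes _ _, map_add]
      simp only [aeval_X, Matrix.cons_val_zero, Matrix.cons_val_one]
      linear_combination X 1 * this
    · have : (C r⁻¹ * (C (1 + r) - 1) : Poly) = 1 := by
        rw [← C_1, ← map_sub, ← map_mul]
        congr 1
        field_simp
        ring
      simp only [Fin.mk_one, AlgHom.comp_apply, hT1, restrictLine, map_mul,
        aeval_X, Matrix.cons_val_zero, Matrix.cons_val_one]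
      rw [show (aeval ![C (1 + r) * X 1, (X 1 : Poly)]) (C r⁻¹ : Poly) = (C r⁻¹ : Poly) from
        AlgHom.commutes _ _, map_sub]
      simp only [aeval_X, Matrix.cons_val_zero, Matrix.cons_val_one]
      linear_combination X 1 * this
  exact DFunLike.congr_fun this f

lemma lineForm_dvd_of_act_matT_eq_neg {f : Poly} (h : act matT f = -f) :
    lineForm (1 + (Real.sqrt 2 : ℝ)) ∣ f := by
  refine lineForm_dvd_of_restrictLine_eq_zero ?_
  have := restrictLine_act_matT f
  rw [h, map_neg] at this
  exact self_eq_neg.1 this.symm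

/-- Since D fixes y = 0 pointwise, f = iᵐ f on that line, so f vanishes there unless m = 0. Dividing
by y lowers the exponent m by one. The bound m < 4 is needed because i⁴ = 1. -/
lemma X_one_pow_dvd_of_act_matD {m : ℕ} (hm : m < 4) {f : Poly}
    (h : act matD f = C (Complex.I ^ m) * f) : X 1 ^ m ∣ f := by
  induction m generalizing f with
  | zero => simp
  | succ m ih =>
    have h1 : Complex.I ^ (m + 1) ≠ 1 := by
      have : m = 0 ∨ m = 1 ∨ m = 2 := by omega
      rcases this with rfl | rfl | rfl <;>
        norm_num [Complex.ext_iff, pow_succ]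
    have h2 := restrictAxis_act_matD f
    rw [h, map_mul, show restrictAxis (C _) = C _ from restrictAxis.commutes _] at h2
    have h3 : restrictAxis f = 0 := by
      have : (C (Complex.I ^ (m + 1) - 1) : Poly) * restrictAxis f = 0 := by
        rw [map_sub, sub_mul, h2, C_1, one_mul, sub_self]
      exact (mul_eq_zero.1 this).resolve_left (C_ne_zero.2 (sub_ne_zero.2 h1))
    obtain ⟨g, rfl⟩ := X_one_dvd_of_restrictAxis_eq_zero h3
    rw [pow_succ']
    refine mul_dvd_mul_left _ (ih (by omega) ?_)
    refine mul_left_cancel₀ (mul_ne_zero (C_ne_zero.2 Complex.I_ne_zero) (X_ne_zero (1 : Fin 2))) ?_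
    rw [map_mul, act_matD_X1] at h
    rw [h, pow_succ, C_mul]
    ring

/-! ### Orbits of linear forms -/

/-- An eigenvector f of the substitution by M is replaced by a unit multiple of itself, so its
divisors are carried along the orbit. -/
lemma pow_dvd_of_act {M : Matrix (Fin 2) (Fin 2) ℂ} {a : ℂ} {f p q : Poly} {m : ℕ} (ha : a ≠ 0)
    (hf : act M f = C a * f) (hp : p ^ m ∣ f) (hq : q ∣ act M p) : q ^ m ∣ f := by
  have h1 : act M p ^ m ∣ C a * f := by
    rw [← hf, ← map_pow]; exact map_dvd _ hp
  have h2 := (pow_dvd_pow_of_dvd hq m).trans h1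
  exact ((ha.isUnit.map (C : ℂ →+* Poly)).dvd_mul_left).1 h2

lemma act_matD_lineForm (a : ℂ) : act matD (lineForm a) = lineForm (a * Complex.I) := by
  simp only [lineForm, map_sub, map_mul, act_C, act_matD_X0, act_matD_X1]
  ring

/-- T sends x - ay to a multiple of (1-a)x + (1+a)y, whose slope parameter is (a+1)/(a-1). The
division-free hypothesis rules out a = 1. -/
lemma lineForm_dvd_act_matT {a b : ℂ} (h : b * (a - 1) = a + 1) :
    lineForm b ∣ act matT (lineForm a) := by
  refine ⟨C (((Real.sqrt 2 : ℝ) : ℂ)⁻¹ * (1 - a)), ?_⟩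
  have h' := congrArg (C : ℂ → Poly) h
  simp only [map_mul, map_sub, map_add, C_1] at h'
  simp only [lineForm, map_sub, map_mul, act_C, act_matT_X0, act_matT_X1, C_1]
  linear_combination (-C ((Real.sqrt 2 : ℝ) : ℂ)⁻¹ * X 1 : Poly) * h'

lemma isRelPrime_X_zero_X_one : IsRelPrime (X 0 : Poly) (X 1) := by
  rw [(X_prime (i := (0 : Fin 2)) (R := ℂ)).irreducible.isRelPrime_iff_not_dvd]
  rw [X_dvd_X]
  simp

lemma isRelPrime_lineForm {a b : ℂ} (h : a ≠ b) : IsRelPrime (lineForm a) (lineForm b) := by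
  intro d ha hb
  have h1 : d ∣ X 1 := by
    have : d ∣ C (b - a) * X 1 := by
      convert dvd_sub ha hb using 1
      simp only [lineForm, map_sub]; ring
    exact (((sub_ne_zero.2 h.symm).isUnit.map (C : ℂ →+* Poly)).dvd_mul_left).1 this
  refine isRelPrime_X_zero_X_one ?_ h1
  have := dvd_add ha (h1.mul_left (C a))
  rwa [lineForm, sub_add_cancel] at this

lemma isRelPrime_quarticForm {a b : ℂ} (h : a ≠ b) :
    IsRelPrime (quarticForm a) (quarticForm b) := by
  intro d ha hb
  have h1 : d ∣ X 1 ^ 4 := by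
    have : d ∣ C (b - a) * X 1 ^ 4 := by
      convert dvd_sub ha hb using 1
      simp only [quarticForm, map_sub]; ring
    exact (((sub_ne_zero.2 h.symm).isUnit.map (C : ℂ →+* Poly)).dvd_mul_left).1 this
  refine isRelPrime_X_zero_X_one.pow (m := 4) (n := 4) ?_ h1
  have := dvd_add ha (h1.mul_left (C a))
  rwa [quarticForm, sub_add_cancel] at this

lemma isRelPrime_X_zero_quarticForm {c : ℂ} (hc : c ≠ 0) : IsRelPrime (X 0) (quarticForm c) := by
  intro d h0 h
  refine isRelPrime_X_zero_X_one.pow_right (n := 4) h0 ?_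
  have h1 := dvd_sub (h0.trans (dvd_pow_self _ (by norm_num : 4 ≠ 0))) h
  rw [quarticForm, sub_sub_cancel] at h1
  exact ((hc.isUnit.map (C : ℂ →+* Poly)).dvd_mul_left).1 h1

lemma isRelPrime_X_one_quarticForm (c : ℂ) : IsRelPrime (X 1) (quarticForm c) := by
  intro d h0 h
  refine isRelPrime_X_zero_X_one.pow_left (m := 4) ?_ h0
  have h1 := dvd_add h ((h0.trans (dvd_pow_self _ (by norm_num : 4 ≠ 0))).mul_left (C c))
  rwa [quarticForm, sub_add_cancel] at h1

/-- D multiplies the slope parameter by i, so x - cy has the orbit c, ci, -c, -ci. These four linear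
forms are pairwise coprime with product x⁴ - c⁴y⁴. -/
lemma quarticForm_pow_dvd {c b : ℂ} {f : Poly} {m : ℕ} (hc : c ≠ 0) (hb : b ≠ 0)
    (hf : act matD f = C b * f) (h : lineForm c ^ m ∣ f) : quarticForm (c ^ 4) ^ m ∣ f := by
  have step : ∀ a, lineForm a ^ m ∣ f → lineForm (a * Complex.I) ^ m ∣ f := fun a ha =>
    pow_dvd_of_act hb hf ha (by rw [act_matD_lineForm])
  have h1 := step _ h
  have h2 := step _ h1
  rw [mul_assoc, Complex.I_mul_I] at h2
  have h3 := step _ h2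
  have key : quarticForm (c ^ 4) = lineForm c * lineForm (c * -1) * (lineForm (c * Complex.I) *
      lineForm (c * -1 * Complex.I)) := by
    have hI := C_I_sq
    simp only [quarticForm, lineForm, map_mul, map_pow, map_neg, C_1]
    linear_combination (X 0 ^ 2 - C c ^ 2 * X 1 ^ 2) * C c ^ 2 * X 1 ^ 2 * hI
  have hne : ∀ u v : ℂ, u ≠ v → IsRelPrime (lineForm (c * u) ^ m) (lineForm (c * v) ^ m) :=
    fun u v huv => (isRelPrime_lineForm fun h => huv (mul_left_cancel₀ hc h)).pow
  have n1 := hne 1 (-1) (by norm_num)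
  have n2 := hne 1 Complex.I (by simp [Complex.ext_iff])
  have n3 := hne 1 (-1 * Complex.I) (by simp [Complex.ext_iff])
  have n4 := hne (-1) Complex.I (by simp [Complex.ext_iff])
  have n5 := hne (-1) (-1 * Complex.I) (by simp [Complex.ext_iff])
  have n6 := hne Complex.I (-1 * Complex.I) (by
    rw [Ne, Complex.ext_iff]; norm_num)
  rw [mul_one] at n1 n2 n3
  rw [← mul_assoc] at n3 n5 n6
  rw [key, mul_pow, mul_pow, mul_pow]
  exact ((n2.mul_right n3).mul_left (n4.mul_right n5)).mul_dvd (n1.mul_dvd h h2) (n6.mul_dvd h1 h3)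

lemma polyGamma_eq : polyGamma = -(X 0 * X 1 * quarticForm 1) := by
  simp only [polyGamma, quarticForm, C_1]; ring

/-- The orbit of y = 0 is reached by T (to x - y), then D² (to x + y), then T (to x); the D-orbit of
x - y supplies x⁴ - y⁴. -/
lemma polyGamma_pow_dvd {a b : ℂ} {f : Poly} {m : ℕ} (ha : a ≠ 0) (hb : b ≠ 0)
    (hf : IsSemi a b f) (h : X 1 ^ m ∣ f) : polyGamma ^ m ∣ f := by
  have h1 : lineForm 1 ^ m ∣ f := pow_dvd_of_act ha hf.1 h
    ⟨C ((Real.sqrt 2 : ℝ) : ℂ)⁻¹, by rw [act_matT_X1, lineForm, C_1]; ring⟩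
  have h2 : lineForm (1 * Complex.I * Complex.I) ^ m ∣ f :=
    pow_dvd_of_act hb hf.2 (pow_dvd_of_act hb hf.2 h1 (act_matD_lineForm _).symm.dvd)
      (act_matD_lineForm _).symm.dvd
  have h3 : X 0 ^ m ∣ f := by
    have := pow_dvd_of_act ha hf.1 h2 (lineForm_dvd_act_matT (b := 0) (by
      rw [mul_assoc, Complex.I_mul_I]; norm_num))
    simpa [lineForm] using this
  have h4 := quarticForm_pow_dvd one_ne_zero hb hf.2 h1
  rw [one_pow] at h4
  have : (X 0 * X 1 * quarticForm 1) ^ m ∣ f := by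
    rw [mul_pow, mul_pow]
    exact ((isRelPrime_X_zero_quarticForm one_ne_zero).pow.mul_left
      (isRelPrime_X_one_quarticForm 1).pow).mul_dvd
        (isRelPrime_X_zero_X_one.pow.mul_dvd h3 h) h4
  rw [polyGamma_eq, neg_pow]
  exact ((isUnit_one.neg.pow m).mul_left_dvd).2 this

/-- The twelve lines of Δ form three D-orbits, with fourth powers of slopes (1+√2)⁴ = 17 + 12√2,
(√2-1)⁴ = 17 - 12√2 and -1. The inequalities with ±1 give coprimality of the quartics with each
other and with Γ. -/
lemma exists_polyDelta_eq : ∃ c d : ℂ, c ≠ 0 ∧ d ≠ 0 ∧ c ≠ d ∧ c ≠ -1 ∧ d ≠ -1 ∧ c ≠ 1 ∧ d ≠ 1 ∧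
    polyDelta = quarticForm c * quarticForm d * quarticForm (-1) ∧
    ∀ {a b : ℂ} {f : Poly} {m : ℕ}, a ≠ 0 → b ≠ 0 → IsSemi a b f →
      lineForm (1 + (Real.sqrt 2 : ℝ)) ^ m ∣ f →
      quarticForm c ^ m ∣ f ∧ quarticForm d ^ m ∣ f ∧ quarticForm (-1) ^ m ∣ f := by
  have hr := ofReal_sqrt_two_sq
  have hr0 := ofReal_sqrt_two_ne_zero
  have hI := Complex.I_sq
  generalize ((Real.sqrt 2 : ℝ) : ℂ) = r at *
  have hcd : (1 + r) * (r - 1) = 1 := by linear_combination hr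
  have hc0 : 1 + r ≠ 0 := left_ne_zero_of_mul_eq_one hcd
  have hd0 : r - 1 ≠ 0 := right_ne_zero_of_mul_eq_one hcd
  have hc4 : (1 + r) ^ 4 = 17 + 12 * r := by
    linear_combination (r ^ 2 + 4 * r + 8) * hr
  have hd4 : (r - 1) ^ 4 = 17 - 12 * r := by
    linear_combination (r ^ 2 - 4 * r + 8) * hr
  -- The eighth root of unity (1-i)/√2 is the slope onto which T sends (1+√2)i.
  have hz4 : ((1 - Complex.I) / r) ^ 4 = -1 := by
    rw [div_pow, div_eq_iff (pow_ne_zero _ hr0)]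
    linear_combination (r ^ 2 + 2) * hr + (Complex.I ^ 2 - 4 * Complex.I + 5) * hI
  have hz0 : (1 - Complex.I) / r ≠ 0 := by
    intro h; rw [h] at hz4; norm_num at hz4
  -- Multiplying v + u√2 = 0 by its conjugate gives v² = 2u².
  have hq : ∀ u v : ℂ, u ^ 2 * 2 ≠ v ^ 2 → v + u * r ≠ 0 := by
    intro u v h h'
    apply h
    linear_combination (-v + u * r) * h' - u ^ 2 * hr
  refine ⟨(1 + r) ^ 4, (r - 1) ^ 4, pow_ne_zero _ hc0, pow_ne_zero _ hd0, ?_, ?_, ?_, ?_, ?_, ?_,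
    ?_⟩
  · rw [hc4, hd4]
    intro h
    exact hr0 (by linear_combination h / 24)
  · rw [hc4]
    intro h
    exact hq 12 18 (by norm_num) (by linear_combination h)
  · rw [hd4]
    intro h
    exact hq (-12) 18 (by norm_num) (by linear_combination h)
  · rw [hc4]
    intro h
    exact hq 12 16 (by norm_num) (by linear_combination h)
  · rw [hd4]
    intro h
    exact hq (-12) 16 (by norm_num) (by linear_combination h)
  · have h' := congrArg (C : ℂ → Poly) hr
    rw [hc4, hd4]
    simp only [map_pow, map_ofNat] at h'
    simp only [polyDelta, quarticForm, map_add, map_sub, map_mul, map_neg, C_1, map_ofNat]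
    linear_combination (144 * X 1 ^ 8 * (X 0 ^ 4 + X 1 ^ 4) : Poly) * h'
  · intro a b f m ha hb hf h
    have h1 : lineForm ((1 + r) * Complex.I) ^ m ∣ f :=
      pow_dvd_of_act hb hf.2 h (act_matD_lineForm _).symm.dvd
    have h2 : lineForm ((1 + r) * Complex.I * Complex.I) ^ m ∣ f :=
      pow_dvd_of_act hb hf.2 h1 (act_matD_lineForm _).symm.dvd
    refine ⟨quarticForm_pow_dvd hc0 hb hf.2 h, quarticForm_pow_dvd hd0 hb hf.2 ?_, ?_⟩
    -- T carries the slope -(1+√2) to √2 - 1.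
    · refine pow_dvd_of_act ha hf.1 h2 (lineForm_dvd_act_matT ?_)
      linear_combination (r ^ 2 - 1 - r - 1) * hI - hr
    · rw [← hz4]
      refine quarticForm_pow_dvd hz0 hb hf.2 ?_
      refine pow_dvd_of_act ha hf.1 h1 (lineForm_dvd_act_matT ?_)
      rw [div_mul_eq_mul_div, div_eq_iff hr0]
      linear_combination -(1 + r) * hI - Complex.I * hr

lemma polyDelta_pow_mul_polyGamma_pow_dvd {a b : ℂ} {f : Poly} {e k : ℕ} (ha : a ≠ 0) (hb : b ≠ 0)
    (hf : IsSemi a b f) (hk : X 1 ^ k ∣ f) (he : lineForm (1 + (Real.sqrt 2 : ℝ)) ^ e ∣ f) :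
    polyDelta ^ e * polyGamma ^ k ∣ f := by
  obtain ⟨c, d, hc, hd, hcd, hc1, hd1, hc2, hd2, hD, H⟩ := exists_polyDelta_eq
  obtain ⟨h1, h2, h3⟩ := H ha hb hf he
  have n1 : (-1 : ℂ) ≠ 0 := by norm_num
  have n2 : (-1 : ℂ) ≠ 1 := by norm_num
  refine IsRelPrime.mul_dvd ?_ ?_ (polyGamma_pow_dvd ha hb hf hk)
  · rw [hD, polyGamma_eq, ← neg_mul, ← neg_mul]
    have hX : ∀ u, u ≠ 0 → u ≠ 1 →
        IsRelPrime (quarticForm u) (-X 0 * X 1 * quarticForm 1) := fun u hu hu1 =>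
      ((isRelPrime_X_zero_quarticForm hu).of_dvd_left (neg_dvd.2 dvd_rfl)).symm.mul_right
        (isRelPrime_X_one_quarticForm u).symm |>.mul_right (isRelPrime_quarticForm hu1)
    exact (((hX c hc hc2).mul_left (hX d hd hd2)).mul_left (hX _ n1 n2)).pow
  · rw [hD, mul_pow, mul_pow]
    exact ((isRelPrime_quarticForm hc1).pow.mul_left (isRelPrime_quarticForm hd1).pow).mul_dvd
      ((isRelPrime_quarticForm hcd).pow.mul_dvd h1 h2) h3

/-! ### Determinants of covariants -/

/-- The matrix V with columns v satisfies V(σx) = ρ(σ)V(x); taking determinants makes det V a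
semi-invariant with character det ρ. -/
lemma act_colDet {m : ℕ} {ρ : grp →* GL (Fin m) ℂ} {v : Fin m → Fin m → Poly}
    (hv : ∀ j, v j ∈ covModule ρ) (σ : grp) :
    act ((σ : GL (Fin 2) ℂ) : Matrix (Fin 2) (Fin 2) ℂ) (colDet v) =
      C (ρ σ : Matrix (Fin m) (Fin m) ℂ).det * colDet v := by
  rw [colDet, AlgHom.map_det, RingHom.map_det, ← Matrix.det_mul]
  congr 1
  ext1 r j
  simp only [AlgHom.mapMatrix_apply, Matrix.map_apply, Matrix.of_apply, Matrix.mul_apply,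
    RingHom.mapMatrix_apply]
  exact hv j σ r

/-- Covariance with respect to the twist of `ρ₂₁` by a character with values `a` at `T` and `b`
at `D`, spelled out at the generators. -/
structure SymCov (a b : ℂ) (F : Fin 3 → Poly) : Prop where
  actT0 : 2 * act matT (F 0) = C a * (F 0 + 2 * F 1 + F 2)
  actT1 : 2 * act matT (F 1) = C a * (F 0 - F 2)
  actT2 : 2 * act matT (F 2) = C a * (F 0 - 2 * F 1 + F 2)
  actD0 : act matD (F 0) = C b * F 0
  actD1 : act matD (F 1) = C (b * Complex.I) * F 1
  actD2 : act matD (F 2) = C (-b) * F 2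

lemma rho_elT (i : ℕ) : (rho i elT : Matrix (Fin 3) (Fin 3) ℂ) =
    (linRep (i - 20) elT : ℂ) • ((1 / 2 : ℂ) • !![1, 2, 1; 1, 0, -1; 1, -2, 1]) := by
  rw [← rho21_elT]; rfl

lemma rho_elD (i : ℕ) : (rho i elD : Matrix (Fin 3) (Fin 3) ℂ) =
    (linRep (i - 20) elD : ℂ) • Matrix.diagonal ![1, Complex.I, -1] := by
  rw [← rho21_elD]; rfl

lemma mem_covModule_rho_iff {i : ℕ} {F : Fin 3 → Poly} : F ∈ covModule (rho i) ↔
    SymCov (linRep (i - 20) elT) (linRep (i - 20) elD) F := by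
  have h2 : (2 : Poly) * C 2⁻¹ = 1 := by
    rw [show (2 : Poly) = C 2 from (map_ofNat C 2).symm, ← map_mul]; norm_num
  have h20 : (2 : Poly) ≠ 0 := two_ne_zero
  have hT : ((elT : GL (Fin 2) ℂ) : Matrix (Fin 2) (Fin 2) ℂ) = matT := rfl
  have hD : ((elD : GL (Fin 2) ℂ) : Matrix (Fin 2) (Fin 2) ℂ) = matD := rfl
  rw [mem_covModule_iff]
  unfold CovAt
  simp only [rho_elT, rho_elD, hT, hD, Fin.forall_fin_succ, Fin.sum_univ_three, Fin.forall_fin_zero,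
    Matrix.smul_apply, Matrix.of_apply, Matrix.diagonal, smul_eq_mul]
  generalize (linRep (i - 20) elT : ℂ) = a
  generalize (linRep (i - 20) elD : ℂ) = b
  simp only [one_div]
  simp [-map_inv₀]
  constructor
  · rintro ⟨⟨h0, h1, h2'⟩, h3, h4, h5⟩
    refine ⟨?_, ?_, ?_, h3, by rw [h4, C_mul], by rw [h5, C_neg, neg_mul]⟩
    · rw [h0]; linear_combination C a * (F 0 + F 2) * h2
    · rw [h1]; linear_combination C a * (F 0 - F 2) * h2
    · rw [h2']; linear_combination C a * (F 0 + F 2) * h2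
  · rintro ⟨h0, h1, h2', h3, h4, h5⟩
    refine ⟨⟨mul_left_cancel₀ h20 ?_, mul_left_cancel₀ h20 ?_, mul_left_cancel₀ h20 ?_⟩, h3,
      by rw [h4, C_mul], by rw [h5, C_neg, neg_mul]⟩
    · rw [h0]; linear_combination -C a * (F 0 + F 2) * h2
    · rw [h1]; linear_combination -C a * (F 0 - F 2) * h2
    · rw [h2']; linear_combination -C a * (F 0 + F 2) * h2

/-- The value of the character `ρ_{i-20}` at `T`. -/
def signT (i : ℕ) : ℂ := if i ≤ 24 then 1 else -1

/-- The exponent `n` with `ρ_{i-20}(D) = iⁿ`. -/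
def expD : ℕ → ℕ
  | 21 => 0
  | 22 => 2
  | 23 => 1
  | 24 => 3
  | 25 => 0
  | 26 => 2
  | 27 => 1
  | 28 => 3
  | _ => 0

lemma linRep_elT_eq_signT {i : ℕ} (hi : 21 ≤ i) (hi' : i ≤ 28) :
    (linRep (i - 20) elT : ℂ) = signT i := by
  obtain ⟨h1, h2, h3, h4, h5, h6, h7, h8⟩ := linRep_elT
  interval_cases i <;> norm_num [signT, h1, h2, h3, h4, h5, h6, h7, h8]

lemma linRep_elD_eq_I_pow {i : ℕ} (hi : 21 ≤ i) (hi' : i ≤ 28) :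
    (linRep (i - 20) elD : ℂ) = Complex.I ^ expD i := by
  obtain ⟨h1, h2, h3, h4, h5, h6, h7, h8⟩ := linRep_elD
  interval_cases i <;> norm_num [expD, h1, h2, h3, h4, h5, h6, h7, h8, pow_succ]

lemma mem_covModule_rho_iff_symCov {i : ℕ} (hi : 21 ≤ i) (hi' : i ≤ 28) {F : Fin 3 → Poly} :
    F ∈ covModule (rho i) ↔ SymCov (signT i) (Complex.I ^ expD i) F := by
  rw [mem_covModule_rho_iff, linRep_elT_eq_signT hi hi', linRep_elD_eq_I_pow hi hi']

/-- Row r is an eigenrow of D with eigenvalue iⁿ⁺ʳ, so a power of y with exponent n + r modulo 4 can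
be taken out of it. -/
lemma X_one_pow_dvd_colDet {v : Fin 3 → Fin 3 → Poly} {a : ℂ} {n : ℕ} (hn : n < 4)
    (hv : ∀ j, SymCov a (Complex.I ^ n) (v j)) :
    X 1 ^ (n + (n + 1) % 4 + (n + 2) % 4) ∣ colDet v := by
  have hI : Complex.I ^ (n + 1) = Complex.I ^ ((n + 1) % 4) := by
    conv_lhs => rw [← Nat.div_add_mod (n + 1) 4, pow_add, pow_mul, Complex.I_pow_four, one_pow,
      one_mul]
  have hI2 : -Complex.I ^ n = Complex.I ^ ((n + 2) % 4) := by
    have : -Complex.I ^ n = Complex.I ^ (n + 2) := by rw [pow_add, Complex.I_sq]; ring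
    rw [this]
    conv_lhs => rw [← Nat.div_add_mod (n + 2) 4, pow_add, pow_mul, Complex.I_pow_four, one_pow,
      one_mul]
  have h0 : ∀ j, X 1 ^ n ∣ v j 0 := fun j => X_one_pow_dvd_of_act_matD hn (hv j).actD0
  have h1 : ∀ j, X 1 ^ ((n + 1) % 4) ∣ v j 1 := fun j =>
    X_one_pow_dvd_of_act_matD (Nat.mod_lt _ (by norm_num)) (by
      rw [← hI, pow_succ]; exact (hv j).actD1)
  have h2 : ∀ j, X 1 ^ ((n + 2) % 4) ∣ v j 2 := fun j =>
    X_one_pow_dvd_of_act_matD (Nat.mod_lt _ (by norm_num)) (by rw [← hI2]; exact (hv j).actD2)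
  choose g0 h0 using h0
  choose g1 h1 using h1
  choose g2 h2 using h2
  refine ⟨(Matrix.of ![g0, g1, g2]).det, ?_⟩
  simp only [colDet, Matrix.det_fin_three, Matrix.of_apply, h0, h1, h2, Matrix.cons_val_zero,
    Matrix.cons_val_one, Matrix.cons_val]
  ring

/-- The row vector (1, -2, -1) is the left eigenvector of ρ₂₁(T) for -1, so this combination changes
sign under T and vanishes on its fixed line. -/
lemma SymCov.lineForm_dvd {b : ℂ} {F : Fin 3 → Poly} (h : SymCov 1 b F) :
    lineForm (1 + (Real.sqrt 2 : ℝ)) ∣ F 0 - 2 * F 1 - F 2 := by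
  refine lineForm_dvd_of_act_matT_eq_neg (mul_left_cancel₀ (two_ne_zero (α := Poly)) ?_)
  have h0 := h.actT0
  have h1 := h.actT1
  have h2 := h.actT2
  rw [C_1] at h0 h1 h2
  simp only [map_sub, map_mul, map_ofNat]
  linear_combination h0 - 2 * h1 - h2

/-- The row vectors (1, 1, 0) and (1, 0, 1) span the left 1-eigenspace of ρ₂₁(T); after the twist by
-1 both combinations change sign under T. -/
lemma SymCov.lineForm_dvd_neg {b : ℂ} {F : Fin 3 → Poly} (h : SymCov (-1) b F) :
    lineForm (1 + (Real.sqrt 2 : ℝ)) ∣ F 0 + F 1 ∧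
      lineForm (1 + (Real.sqrt 2 : ℝ)) ∣ F 0 + F 2 := by
  have h0 := h.actT0
  have h1 := h.actT1
  have h2 := h.actT2
  rw [C_neg, C_1] at h0 h1 h2
  constructor
  all_goals
    refine lineForm_dvd_of_act_matT_eq_neg (mul_left_cancel₀ (two_ne_zero (α := Poly)) ?_)
    rw [map_add]
  · linear_combination h0 + h1
  · linear_combination h0 + h2

lemma lineForm_dvd_colDet {v : Fin 3 → Fin 3 → Poly} {b : ℂ} (hv : ∀ j, SymCov 1 b (v j)) :
    lineForm (1 + (Real.sqrt 2 : ℝ)) ∣ colDet v := by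
  choose g h using fun j => (hv j).lineForm_dvd
  have h' : ∀ j, v j 0 = lineForm (1 + (Real.sqrt 2 : ℝ)) * g j + 2 * v j 1 + v j 2 := fun j => by
    rw [← h j]; ring
  refine ⟨(Matrix.of ![g, fun j => v j 1, fun j => v j 2]).det, ?_⟩
  simp only [colDet, Matrix.det_fin_three, Matrix.of_apply, h', Matrix.cons_val_zero,
    Matrix.cons_val_one, Matrix.cons_val]
  ring

/-- Adding row 0 to the other two rows makes each of them divisible by the linear form, without
changing the determinant. -/
lemma lineForm_sq_dvd_colDet {v : Fin 3 → Fin 3 → Poly} {b : ℂ}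
    (hv : ∀ j, SymCov (-1) b (v j)) : lineForm (1 + (Real.sqrt 2 : ℝ)) ^ 2 ∣ colDet v := by
  choose g h using fun j => (hv j).lineForm_dvd_neg.1
  choose k hk using fun j => (hv j).lineForm_dvd_neg.2
  have h' : ∀ j, v j 1 = lineForm (1 + (Real.sqrt 2 : ℝ)) * g j - v j 0 := fun j => by
    rw [← h j]; ring
  have hk' : ∀ j, v j 2 = lineForm (1 + (Real.sqrt 2 : ℝ)) * k j - v j 0 := fun j => by
    rw [← hk j]; ring
  refine ⟨(Matrix.of ![fun j => v j 0, g, k]).det, ?_⟩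
  simp only [colDet, Matrix.det_fin_three, Matrix.of_apply, h', hk', Matrix.cons_val_zero,
    Matrix.cons_val_one, Matrix.cons_val]
  ring

lemma polyDelta_mul_polyGamma_dvd_colDet {i : ℕ} (hi : 21 ≤ i) (hi' : i ≤ 28)
    {v : Fin 3 → Fin 3 → Poly} (hv : ∀ j, v j ∈ covModule (rho i)) :
    polyDelta ^ eTable i * polyGamma ^ kTable i ∣ colDet v := by
  have hv' := fun j => (mem_covModule_rho_iff_symCov hi hi').1 (hv j)
  have hdet : ∀ σ, (rho i σ : Matrix (Fin 3) (Fin 3) ℂ).det ≠ 0 := fun σ =>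
    (Matrix.isUnits_det_units (rho i σ)).ne_zero
  refine polyDelta_pow_mul_polyGamma_pow_dvd (hdet elT) (hdet elD)
    ⟨act_colDet hv elT, act_colDet hv elD⟩ ?_ ?_
  · have hn : expD i < 4 := by interval_cases i <;> norm_num [expD]
    -- The exponent k_i is the sum of the residues modulo 4 of the D-exponents of the three rows.
    have hk : kTable i = expD i + (expD i + 1) % 4 + (expD i + 2) % 4 := by
      interval_cases i <;> norm_num [expD, kTable]
    rw [hk]
    exact X_one_pow_dvd_colDet hn hv'
  · by_cases h : i ≤ 24
    · have he : eTable i = 1 := by interval_cases i <;> rfl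
      rw [he, pow_one]
      rw [signT, if_pos h] at hv'
      exact lineForm_dvd_colDet hv'
    · have he : eTable i = 2 := by
        have : 25 ≤ i := by omega
        interval_cases i <;> rfl
      rw [he]
      rw [signT, if_neg h] at hv'
      exact lineForm_sq_dvd_colDet hv'

/-! ### Homogeneity and the action of `T` on forms of even degree -/

lemma isHomogeneous_of_eq {p : Poly} {m n : ℕ} (h : p.IsHomogeneous m) (hmn : m = n) :
    p.IsHomogeneous n := hmn ▸ h

lemma isHomogeneous_ofNat (k : ℕ) [k.AtLeastTwo] :
    (OfNat.ofNat k : Poly).IsHomogeneous 0 := by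
  rw [← map_ofNat (C : ℂ →+* Poly) k]
  exact isHomogeneous_C _ _

/-- The substitution `f(x, y) ↦ f(x + y, x - y)`. -/
def hadamard : Poly →ₐ[ℂ] Poly := aeval ![X 0 + X 1, X 0 - X 1]

/-- In degree 2n the factor (1/√2)²ⁿ cancels 2ⁿ. This removes √2, so covariance of explicit forms
under T becomes an identity with integer coefficients. -/
lemma two_pow_mul_act_matT {p : Poly} {n : ℕ} (hp : p.IsHomogeneous (2 * n)) :
    2 ^ n * act matT p = hadamard p := by
  have hm : ∀ s : Fin 2 →₀ ℕ, s.degree = 2 * n → ∀ c : ℂ,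
      2 ^ n * act matT (monomial s c) = hadamard (monomial s c) := fun s hs c => by
    rw [Finsupp.degree_eq_sum, Fin.sum_univ_two] at hs
    rw [monomial_eq, Finsupp.prod_fintype _ _ (fun i => pow_zero _), Fin.prod_univ_two]
    simp only [map_mul, map_pow, act_matT_X0, act_matT_X1, hadamard, aeval_X,
      Matrix.cons_val_zero, Matrix.cons_val_one, mul_pow, algHom_C, algebraMap_eq]
    have h2 : (2 : Poly) ^ n * (C ((Real.sqrt 2 : ℝ) : ℂ)⁻¹ ^ s 0 *
        C ((Real.sqrt 2 : ℝ) : ℂ)⁻¹ ^ s 1) = 1 := by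
      rw [← pow_add, hs, pow_mul, ← mul_pow, two_mul_sqrt_two_inv_sq, one_pow]
    linear_combination C c * (X 0 + X 1) ^ s 0 * (X 0 - X 1) ^ s 1 * h2
  rw [p.as_sum, map_sum, map_sum, Finset.mul_sum]
  refine Finset.sum_congr rfl fun s hs => hm s ?_ _
  by_contra h
  exact (mem_support_iff.1 hs) (hp.coeff_eq_zero h)

lemma SymCov.of_hadamard {a b : ℂ} {F : Fin 3 → Poly} {n : ℕ}
    (hF : ∀ r, (F r).IsHomogeneous (2 * n))
    (h0 : 2 * hadamard (F 0) = 2 ^ n * (C a * (F 0 + 2 * F 1 + F 2)))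
    (h1 : 2 * hadamard (F 1) = 2 ^ n * (C a * (F 0 - F 2)))
    (h2 : 2 * hadamard (F 2) = 2 ^ n * (C a * (F 0 - 2 * F 1 + F 2)))
    (h3 : act matD (F 0) = C b * F 0) (h4 : act matD (F 1) = C (b * Complex.I) * F 1)
    (h5 : act matD (F 2) = C (-b) * F 2) : SymCov a b F := by
  have hn : (2 : Poly) ^ n ≠ 0 := pow_ne_zero _ two_ne_zero
  refine ⟨mul_left_cancel₀ hn ?_, mul_left_cancel₀ hn ?_, mul_left_cancel₀ hn ?_, h3, h4, h5⟩
  · rw [← h0, ← two_pow_mul_act_matT (hF 0)]; ring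
  · rw [← h1, ← two_pow_mul_act_matT (hF 1)]; ring
  · rw [← h2, ← two_pow_mul_act_matT (hF 2)]; ring

lemma SymCov.smul {a b a' b' : ℂ} {f : Poly} {F : Fin 3 → Poly} (hf : IsSemi a b f)
    (hF : SymCov a' b' F) : SymCov (a * a') (b * b') (f • F) := by
  obtain ⟨h0, h1, h2, h3, h4, h5⟩ := hF
  refine ⟨?_, ?_, ?_, ?_, ?_, ?_⟩ <;>
    simp only [Pi.smul_apply, smul_eq_mul, map_mul, map_neg, hf.1, hf.2] at h3 h4 h5 ⊢
  · linear_combination C a * f * h0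
  · linear_combination C a * f * h1
  · linear_combination C a * f * h2
  · rw [h3]; ring
  · rw [h4]; ring
  · rw [h5]; ring

lemma isSemi_C (c : ℂ) : IsSemi 1 1 (C c) := by
  constructor <;> rw [act_C, C_1, one_mul]

lemma isHomogeneous_polyGamma : polyGamma.IsHomogeneous 6 := by
  unfold polyGamma
  repeat' first | apply IsHomogeneous.add | apply IsHomogeneous.sub | apply IsHomogeneous.neg
  all_goals
    apply isHomogeneous_of_eq
    repeat' first
      | apply IsHomogeneous.mul | apply IsHomogeneous.pow | apply isHomogeneous_X
      | apply isHomogeneous_ofNat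
    norm_num

lemma isHomogeneous_polyDelta : polyDelta.IsHomogeneous 12 := by
  unfold polyDelta
  repeat' first | apply IsHomogeneous.add | apply IsHomogeneous.sub | apply IsHomogeneous.neg
  all_goals
    apply isHomogeneous_of_eq
    repeat' first
      | apply IsHomogeneous.mul | apply IsHomogeneous.pow | apply isHomogeneous_X
      | apply isHomogeneous_ofNat
    norm_num

lemma isHomogeneous_polyTheta : polyTheta.IsHomogeneous 8 := by
  unfold polyTheta
  repeat' first | apply IsHomogeneous.add | apply IsHomogeneous.sub | apply IsHomogeneous.neg
  all_goals
    apply isHomogeneous_of_eq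
    repeat' first
      | apply IsHomogeneous.mul | apply IsHomogeneous.pow | apply isHomogeneous_X
      | apply isHomogeneous_ofNat
    norm_num

lemma isHomogeneous_polyPhi : polyPhi.IsHomogeneous 24 := by
  unfold polyPhi
  repeat' first | apply IsHomogeneous.add | apply IsHomogeneous.sub | apply IsHomogeneous.neg
  all_goals
    apply isHomogeneous_of_eq
    repeat' first
      | apply IsHomogeneous.mul | apply IsHomogeneous.pow | apply isHomogeneous_X
      | apply isHomogeneous_ofNat
    norm_num

/-! ### Semi-invariance of Γ and Δ -/

section

set_option linter.unusedSimpArgs false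

lemma C_I_pow : (C Complex.I : Poly) ^ 2 = -1 ∧ (C Complex.I : Poly) ^ 3 = -C Complex.I ∧
    (C Complex.I : Poly) ^ 4 = 1 ∧ (C Complex.I : Poly) ^ 5 = C Complex.I ∧
    (C Complex.I : Poly) ^ 6 = -1 ∧ (C Complex.I : Poly) ^ 7 = -C Complex.I ∧
    (C Complex.I : Poly) ^ 8 = 1 ∧ (C Complex.I : Poly) ^ 9 = C Complex.I ∧
    (C Complex.I : Poly) ^ 10 = -1 ∧ (C Complex.I : Poly) ^ 11 = -C Complex.I ∧
    (C Complex.I : Poly) ^ 12 = 1 := by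
  have h := C_I_sq
  generalize (C Complex.I : Poly) = u at *
  have h3 : u ^ 3 = -u := by linear_combination u * h
  have h4 : u ^ 4 = 1 := by linear_combination (u ^ 2 - 1) * h
  have h8 : u ^ 8 = 1 := by linear_combination (u ^ 4 + 1) * h4
  refine ⟨h, h3, h4, ?_, ?_, ?_, h8, ?_, ?_, ?_, ?_⟩
  · linear_combination u * h4
  · linear_combination u ^ 2 * h4 + h
  · linear_combination u ^ 3 * h4 + h3
  · linear_combination u * h8
  · linear_combination u ^ 2 * h8 + h
  · linear_combination u ^ 3 * h8 + h3
  · linear_combination u ^ 4 * h8 + h4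

lemma polyGamma_isSemi : IsSemi 1 (Complex.I ^ 1) polyGamma := by
  obtain ⟨h2, h3, h4, h5, h6, h7, h8, h9, h10, h11, h12⟩ := C_I_pow
  constructor
  · refine mul_left_cancel₀ (pow_ne_zero 3 (two_ne_zero (α := Poly))) ?_
    rw [two_pow_mul_act_matT (n := 3) isHomogeneous_polyGamma]
    simp only [polyGamma, hadamard, map_add, map_sub, map_neg, map_mul, map_pow, map_ofNat, aeval_X,
      Matrix.cons_val_zero, Matrix.cons_val_one, C_1]
    ring
  · simp only [polyGamma, map_add, map_sub, map_neg, map_mul, map_pow, map_ofNat, act_matD_X0,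
      act_matD_X1]
    generalize (C Complex.I : Poly) = u at *
    ring_nf
    simp only [h5]

lemma polyDelta_isSemi : IsSemi (-1) (Complex.I ^ 0) polyDelta := by
  obtain ⟨h2, h3, h4, h5, h6, h7, h8, h9, h10, h11, h12⟩ := C_I_pow
  constructor
  · refine mul_left_cancel₀ (pow_ne_zero 6 (two_ne_zero (α := Poly))) ?_
    rw [two_pow_mul_act_matT (n := 6) isHomogeneous_polyDelta]
    simp only [polyDelta, hadamard, map_add, map_sub, map_neg, map_mul, map_pow, map_ofNat, aeval_X,
      Matrix.cons_val_zero, Matrix.cons_val_one, C_1]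
    ring
  · simp only [polyDelta, map_add, map_sub, map_neg, map_mul, map_pow, map_ofNat, act_matD_X0,
      act_matD_X1]
    generalize (C Complex.I : Poly) = u at *
    ring_nf
    simp only [h4, h8, h12]
    ring

/-! ### Explicit covariants -/

set_option linter.unusedTactic false

/-- The covariant with components `x², xy, y²`. -/
def covId : Fin 3 → Poly :=
  ![X 0 ^ 2,
    X 0 * X 1,
    X 1 ^ 2]

/-- The square of the rotated gradient of `Γ`. -/
def covGammaSq : Fin 3 → Poly :=
  ![X 0 ^ 10 - 10 * X 0 ^ 6 * X 1 ^ 4 + 25 * X 0 ^ 2 * X 1 ^ 8,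
    -(5 * X 0 ^ 9 * X 1) + 26 * X 0 ^ 5 * X 1 ^ 5 - 5 * X 0 * X 1 ^ 9,
    25 * X 0 ^ 8 * X 1 ^ 2 - 10 * X 0 ^ 4 * X 1 ^ 6 + X 1 ^ 10]

/-- The product of the rotated gradients of `Γ` and `θ`, up to a scalar. -/
def covGammaTheta : Fin 3 → Poly :=
  ![-(14 * X 0 ^ 9 * X 1 ^ 3) + 68 * X 0 ^ 5 * X 1 ^ 7 + 10 * X 0 * X 1 ^ 11,
    X 0 ^ 12 + 37 * X 0 ^ 8 * X 1 ^ 4 - 37 * X 0 ^ 4 * X 1 ^ 8 - X 1 ^ 12,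
    -(10 * X 0 ^ 11 * X 1) - 68 * X 0 ^ 7 * X 1 ^ 5 + 14 * X 0 ^ 3 * X 1 ^ 9]

/-- The product of `(x, y)` and the rotated gradient of `Γ`, up to a scalar. -/
def covIdGamma : Fin 3 → Poly :=
  ![-(X 0 ^ 6) + 5 * X 0 ^ 2 * X 1 ^ 4,
    2 * X 0 ^ 5 * X 1 + 2 * X 0 * X 1 ^ 5,
    5 * X 0 ^ 4 * X 1 ^ 2 - X 1 ^ 6]

/-- The product of `(x, y)` and the rotated gradient of `θ`, up to a scalar. -/
def covIdTheta : Fin 3 → Poly :=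
  ![14 * X 0 ^ 5 * X 1 ^ 3 + 2 * X 0 * X 1 ^ 7,
    -(X 0 ^ 8) + X 1 ^ 8,
    -(2 * X 0 ^ 7 * X 1) - 14 * X 0 ^ 3 * X 1 ^ 5]

/-- The rotated Hessian of `θ`, up to a scalar. -/
def hessTheta : Fin 3 → Poly :=
  ![3 * X 0 ^ 4 * X 1 ^ 2 + X 1 ^ 6,
    -(4 * X 0 ^ 3 * X 1 ^ 3),
    X 0 ^ 6 + 3 * X 0 ^ 2 * X 1 ^ 4]

/-- The rotated Hessian of `Δ`, up to a scalar. -/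
def hessDelta : Fin 3 → Poly :=
  ![-(3 * X 0 ^ 8 * X 1 ^ 2) - 14 * X 0 ^ 4 * X 1 ^ 6 + X 1 ^ 10,
    8 * X 0 ^ 7 * X 1 ^ 3 + 8 * X 0 ^ 3 * X 1 ^ 7,
    X 0 ^ 10 - 14 * X 0 ^ 6 * X 1 ^ 4 - 3 * X 0 ^ 2 * X 1 ^ 8]

/-- The rotated Hessian of `Γ`, up to a scalar. -/
def hessGamma : Fin 3 → Poly :=
  ![4 * X 0 * X 1 ^ 3,
    X 0 ^ 4 - X 1 ^ 4,
    -(4 * X 0 ^ 3 * X 1)]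

lemma isHomogeneous_covId (r : Fin 3) : (covId r).IsHomogeneous 2 := by
  fin_cases r <;> simp only [covId, Fin.zero_eta, Fin.mk_one, Fin.reduceFinMk,
    Matrix.cons_val_zero, Matrix.cons_val_one, Matrix.cons_val]
  all_goals repeat' first
    | apply IsHomogeneous.add | apply IsHomogeneous.sub | apply IsHomogeneous.neg
  all_goals
    apply isHomogeneous_of_eq
    repeat' first
      | apply IsHomogeneous.mul | apply IsHomogeneous.pow | apply isHomogeneous_X
      | apply isHomogeneous_ofNat
    norm_num

/-- Pattern for all the explicit covariants: the three conditions at T are polynomial identities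
over the integers, and the three at D only need powers of i reduced. -/
lemma covId_symCov : SymCov 1 (Complex.I ^ 0) covId := by
  obtain ⟨h2, h3, h4, h5, h6, h7, h8, h9, h10, h11, h12⟩ := C_I_pow
  refine SymCov.of_hadamard (n := 1) (fun r => isHomogeneous_covId r) ?_ ?_ ?_ ?_ ?_ ?_ <;>
    simp only [covId, hadamard, map_add, map_sub, map_neg, map_mul, map_pow, map_ofNat, aeval_X,
      Matrix.cons_val_zero, Matrix.cons_val_one, Matrix.cons_val, act_matD_X0, act_matD_X1, C_1]
  · ring
  · ring
  · ring
  all_goals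
    generalize (C Complex.I : Poly) = u at *
    ring_nf
    try simp only [h2, h3, h4, h5, h6, h7, h8, h9, h10, h11, h12]
    try ring

lemma isHomogeneous_covGammaSq (r : Fin 3) : (covGammaSq r).IsHomogeneous 10 := by
  fin_cases r <;> simp only [covGammaSq, Fin.zero_eta, Fin.mk_one, Fin.reduceFinMk,
    Matrix.cons_val_zero, Matrix.cons_val_one, Matrix.cons_val]
  all_goals repeat' first
    | apply IsHomogeneous.add | apply IsHomogeneous.sub | apply IsHomogeneous.neg
  all_goals
    apply isHomogeneous_of_eq
    repeat' first
      | apply IsHomogeneous.mul | apply IsHomogeneous.pow | apply isHomogeneous_X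
      | apply isHomogeneous_ofNat
    norm_num

lemma covGammaSq_symCov : SymCov 1 (Complex.I ^ 0) covGammaSq := by
  obtain ⟨h2, h3, h4, h5, h6, h7, h8, h9, h10, h11, h12⟩ := C_I_pow
  refine SymCov.of_hadamard (n := 5) (fun r => isHomogeneous_covGammaSq r) ?_ ?_ ?_ ?_ ?_ ?_ <;>
    simp only [covGammaSq, hadamard, map_add, map_sub, map_neg, map_mul, map_pow, map_ofNat, aeval_X,
      Matrix.cons_val_zero, Matrix.cons_val_one, Matrix.cons_val, act_matD_X0, act_matD_X1, C_1]
  · ring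
  · ring
  · ring
  all_goals
    generalize (C Complex.I : Poly) = u at *
    ring_nf
    try simp only [h2, h3, h4, h5, h6, h7, h8, h9, h10, h11, h12]
    try ring

lemma isHomogeneous_covGammaTheta (r : Fin 3) : (covGammaTheta r).IsHomogeneous 12 := by
  fin_cases r <;> simp only [covGammaTheta, Fin.zero_eta, Fin.mk_one, Fin.reduceFinMk,
    Matrix.cons_val_zero, Matrix.cons_val_one, Matrix.cons_val]
  all_goals repeat' first
    | apply IsHomogeneous.add | apply IsHomogeneous.sub | apply IsHomogeneous.neg
  all_goals
    apply isHomogeneous_of_eq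
    repeat' first
      | apply IsHomogeneous.mul | apply IsHomogeneous.pow | apply isHomogeneous_X
      | apply isHomogeneous_ofNat
    norm_num

lemma covGammaTheta_symCov : SymCov 1 (Complex.I ^ 3) covGammaTheta := by
  obtain ⟨h2, h3, h4, h5, h6, h7, h8, h9, h10, h11, h12⟩ := C_I_pow
  refine SymCov.of_hadamard (n := 6) (fun r => isHomogeneous_covGammaTheta r) ?_ ?_ ?_ ?_ ?_ ?_ <;>
    simp only [covGammaTheta, hadamard, map_add, map_sub, map_neg, map_mul, map_pow, map_ofNat, aeval_X,
      Matrix.cons_val_zero, Matrix.cons_val_one, Matrix.cons_val, act_matD_X0, act_matD_X1, C_1]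
  · ring
  · ring
  · ring
  all_goals
    generalize (C Complex.I : Poly) = u at *
    ring_nf
    try simp only [h2, h3, h4, h5, h6, h7, h8, h9, h10, h11, h12]
    try ring

lemma isHomogeneous_covIdGamma (r : Fin 3) : (covIdGamma r).IsHomogeneous 6 := by
  fin_cases r <;> simp only [covIdGamma, Fin.zero_eta, Fin.mk_one, Fin.reduceFinMk,
    Matrix.cons_val_zero, Matrix.cons_val_one, Matrix.cons_val]
  all_goals repeat' first
    | apply IsHomogeneous.add | apply IsHomogeneous.sub | apply IsHomogeneous.neg
  all_goals
    apply isHomogeneous_of_eq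
    repeat' first
      | apply IsHomogeneous.mul | apply IsHomogeneous.pow | apply isHomogeneous_X
      | apply isHomogeneous_ofNat
    norm_num

lemma covIdGamma_symCov : SymCov (-1) (Complex.I ^ 0) covIdGamma := by
  obtain ⟨h2, h3, h4, h5, h6, h7, h8, h9, h10, h11, h12⟩ := C_I_pow
  refine SymCov.of_hadamard (n := 3) (fun r => isHomogeneous_covIdGamma r) ?_ ?_ ?_ ?_ ?_ ?_ <;>
    simp only [covIdGamma, hadamard, map_add, map_sub, map_neg, map_mul, map_pow, map_ofNat, aeval_X,
      Matrix.cons_val_zero, Matrix.cons_val_one, Matrix.cons_val, act_matD_X0, act_matD_X1, C_1]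
  · ring
  · ring
  · ring
  all_goals
    generalize (C Complex.I : Poly) = u at *
    ring_nf
    try simp only [h2, h3, h4, h5, h6, h7, h8, h9, h10, h11, h12]
    try ring

lemma isHomogeneous_covIdTheta (r : Fin 3) : (covIdTheta r).IsHomogeneous 8 := by
  fin_cases r <;> simp only [covIdTheta, Fin.zero_eta, Fin.mk_one, Fin.reduceFinMk,
    Matrix.cons_val_zero, Matrix.cons_val_one, Matrix.cons_val]
  all_goals repeat' first
    | apply IsHomogeneous.add | apply IsHomogeneous.sub | apply IsHomogeneous.neg
  all_goals
    apply isHomogeneous_of_eq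
    repeat' first
      | apply IsHomogeneous.mul | apply IsHomogeneous.pow | apply isHomogeneous_X
      | apply isHomogeneous_ofNat
    norm_num

lemma covIdTheta_symCov : SymCov (-1) (Complex.I ^ 3) covIdTheta := by
  obtain ⟨h2, h3, h4, h5, h6, h7, h8, h9, h10, h11, h12⟩ := C_I_pow
  refine SymCov.of_hadamard (n := 4) (fun r => isHomogeneous_covIdTheta r) ?_ ?_ ?_ ?_ ?_ ?_ <;>
    simp only [covIdTheta, hadamard, map_add, map_sub, map_neg, map_mul, map_pow, map_ofNat, aeval_X,
      Matrix.cons_val_zero, Matrix.cons_val_one, Matrix.cons_val, act_matD_X0, act_matD_X1, C_1]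
  · ring
  · ring
  · ring
  all_goals
    generalize (C Complex.I : Poly) = u at *
    ring_nf
    try simp only [h2, h3, h4, h5, h6, h7, h8, h9, h10, h11, h12]
    try ring

lemma isHomogeneous_hessTheta (r : Fin 3) : (hessTheta r).IsHomogeneous 6 := by
  fin_cases r <;> simp only [hessTheta, Fin.zero_eta, Fin.mk_one, Fin.reduceFinMk,
    Matrix.cons_val_zero, Matrix.cons_val_one, Matrix.cons_val]
  all_goals repeat' first
    | apply IsHomogeneous.add | apply IsHomogeneous.sub | apply IsHomogeneous.neg
  all_goals
    apply isHomogeneous_of_eq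
    repeat' first
      | apply IsHomogeneous.mul | apply IsHomogeneous.pow | apply isHomogeneous_X
      | apply isHomogeneous_ofNat
    norm_num

lemma hessTheta_symCov : SymCov 1 (Complex.I ^ 2) hessTheta := by
  obtain ⟨h2, h3, h4, h5, h6, h7, h8, h9, h10, h11, h12⟩ := C_I_pow
  refine SymCov.of_hadamard (n := 3) (fun r => isHomogeneous_hessTheta r) ?_ ?_ ?_ ?_ ?_ ?_ <;>
    simp only [hessTheta, hadamard, map_add, map_sub, map_neg, map_mul, map_pow, map_ofNat, aeval_X,
      Matrix.cons_val_zero, Matrix.cons_val_one, Matrix.cons_val, act_matD_X0, act_matD_X1, C_1]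
  · ring
  · ring
  · ring
  all_goals
    generalize (C Complex.I : Poly) = u at *
    ring_nf
    try simp only [h2, h3, h4, h5, h6, h7, h8, h9, h10, h11, h12]
    try ring

lemma isHomogeneous_hessDelta (r : Fin 3) : (hessDelta r).IsHomogeneous 10 := by
  fin_cases r <;> simp only [hessDelta, Fin.zero_eta, Fin.mk_one, Fin.reduceFinMk,
    Matrix.cons_val_zero, Matrix.cons_val_one, Matrix.cons_val]
  all_goals repeat' first
    | apply IsHomogeneous.add | apply IsHomogeneous.sub | apply IsHomogeneous.neg
  all_goals
    apply isHomogeneous_of_eq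
    repeat' first
      | apply IsHomogeneous.mul | apply IsHomogeneous.pow | apply isHomogeneous_X
      | apply isHomogeneous_ofNat
    norm_num

lemma hessDelta_symCov : SymCov (-1) (Complex.I ^ 2) hessDelta := by
  obtain ⟨h2, h3, h4, h5, h6, h7, h8, h9, h10, h11, h12⟩ := C_I_pow
  refine SymCov.of_hadamard (n := 5) (fun r => isHomogeneous_hessDelta r) ?_ ?_ ?_ ?_ ?_ ?_ <;>
    simp only [hessDelta, hadamard, map_add, map_sub, map_neg, map_mul, map_pow, map_ofNat, aeval_X,
      Matrix.cons_val_zero, Matrix.cons_val_one, Matrix.cons_val, act_matD_X0, act_matD_X1, C_1]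
  · ring
  · ring
  · ring
  all_goals
    generalize (C Complex.I : Poly) = u at *
    ring_nf
    try simp only [h2, h3, h4, h5, h6, h7, h8, h9, h10, h11, h12]
    try ring

lemma isHomogeneous_hessGamma (r : Fin 3) : (hessGamma r).IsHomogeneous 4 := by
  fin_cases r <;> simp only [hessGamma, Fin.zero_eta, Fin.mk_one, Fin.reduceFinMk,
    Matrix.cons_val_zero, Matrix.cons_val_one, Matrix.cons_val]
  all_goals repeat' first
    | apply IsHomogeneous.add | apply IsHomogeneous.sub | apply IsHomogeneous.neg
  all_goals
    apply isHomogeneous_of_eq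
    repeat' first
      | apply IsHomogeneous.mul | apply IsHomogeneous.pow | apply isHomogeneous_X
      | apply isHomogeneous_ofNat
    norm_num

lemma hessGamma_symCov : SymCov 1 (Complex.I ^ 3) hessGamma := by
  obtain ⟨h2, h3, h4, h5, h6, h7, h8, h9, h10, h11, h12⟩ := C_I_pow
  refine SymCov.of_hadamard (n := 2) (fun r => isHomogeneous_hessGamma r) ?_ ?_ ?_ ?_ ?_ ?_ <;>
    simp only [hessGamma, hadamard, map_add, map_sub, map_neg, map_mul, map_pow, map_ofNat, aeval_X,
      Matrix.cons_val_zero, Matrix.cons_val_one, Matrix.cons_val, act_matD_X0, act_matD_X1, C_1]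
  · ring
  · ring
  · ring
  all_goals
    generalize (C Complex.I : Poly) = u at *
    ring_nf
    try simp only [h2, h3, h4, h5, h6, h7, h8, h9, h10, h11, h12]
    try ring

/-! ### Determinants of triples of explicit covariants -/

lemma colDet_covId_covGammaSq_covGammaTheta : colDet ![covId, covGammaSq, covGammaTheta] =
    36 * polyDelta ^ 1 * polyGamma ^ 2 := by
  simp only [colDet, Matrix.det_fin_three, Matrix.of_apply, Matrix.cons_val_zero,
    Matrix.cons_val_one, Matrix.cons_val, covGammaSq, covGammaTheta, covId, polyDelta, polyGamma]
  ring

lemma colDet_covIdGamma_covId_covGammaSq : colDet ![covIdGamma, covId, covGammaSq] =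
    108 * polyDelta ^ 0 * polyGamma ^ 3 := by
  simp only [colDet, Matrix.det_fin_three, Matrix.of_apply, Matrix.cons_val_zero,
    Matrix.cons_val_one, Matrix.cons_val, covGammaSq, covId, covIdGamma, polyDelta, polyGamma]
  ring

lemma colDet_hessTheta : colDet ![hessTheta, covId, covGammaSq] =
    6 * polyDelta ^ 1 * polyGamma ^ 1 := by
  simp only [colDet, Matrix.det_fin_three, Matrix.of_apply, Matrix.cons_val_zero,
    Matrix.cons_val_one, Matrix.cons_val, covGammaSq, covId, hessTheta, polyDelta, polyGamma]
  ring

lemma colDet_hessDelta : colDet ![hessDelta, covIdGamma, covId] =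
    3 * polyDelta ^ 1 * polyGamma ^ 1 := by
  simp only [colDet, Matrix.det_fin_three, Matrix.of_apply, Matrix.cons_val_zero,
    Matrix.cons_val_one, Matrix.cons_val, covId, covIdGamma, hessDelta, polyDelta, polyGamma]
  ring

lemma colDet_hessGamma_covGammaTheta : colDet ![hessGamma, covGammaTheta, covId] =
    6 * polyDelta ^ 1 * polyGamma ^ 1 := by
  simp only [colDet, Matrix.det_fin_three, Matrix.of_apply, Matrix.cons_val_zero,
    Matrix.cons_val_one, Matrix.cons_val, covGammaTheta, covId, hessGamma, polyDelta, polyGamma]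
  ring

lemma colDet_covIdTheta_hessGamma : colDet ![covIdTheta, hessGamma, covIdGamma] =
    6 * polyDelta ^ 1 * polyGamma ^ 1 := by
  simp only [colDet, Matrix.det_fin_three, Matrix.of_apply, Matrix.cons_val_zero,
    Matrix.cons_val_one, Matrix.cons_val, covIdGamma, covIdTheta, hessGamma, polyDelta, polyGamma]
  ring

end

/-! ### Existence of covariants with the required determinant -/

/-- A homogeneous covariant of degree `d` for the twist of `ρ₂₁` by the character with values `a`
at `T` and `iⁿ` at `D`. -/
def IsHomCov (a : ℂ) (n d : ℕ) (F : Fin 3 → Poly) : Prop :=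
  SymCov a (Complex.I ^ n) F ∧ ∀ r, (F r).IsHomogeneous d

/-- A homogeneous semi-invariant of degree `d` with values `a` at `T` and `iⁿ` at `D`. -/
def IsHomSemi (a : ℂ) (n d : ℕ) (f : Poly) : Prop :=
  IsSemi a (Complex.I ^ n) f ∧ f.IsHomogeneous d

lemma IsHomSemi.smul {a a' : ℂ} {n n' d d' : ℕ} {f : Poly} {F : Fin 3 → Poly}
    (hf : IsHomSemi a n d f) (hF : IsHomCov a' n' d' F) :
    IsHomCov (a * a') (n + n') (d + d') (f • F) :=
  ⟨by rw [pow_add]; exact hF.1.smul hf.1, fun r => hf.2.mul (hF.2 r)⟩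

lemma IsHomSemi.mul {a a' : ℂ} {n n' d d' : ℕ} {f g : Poly}
    (hf : IsHomSemi a n d f) (hg : IsHomSemi a' n' d' g) :
    IsHomSemi (a * a') (n + n') (d + d') (f * g) :=
  ⟨by rw [pow_add]; exact hf.1.mul hg.1, hf.2.mul hg.2⟩

lemma IsHomSemi.pow {a : ℂ} {n d : ℕ} {f : Poly} (hf : IsHomSemi a n d f) (k : ℕ) :
    IsHomSemi (a ^ k) (n * k) (d * k) (f ^ k) :=
  ⟨by rw [pow_mul]; exact hf.1.pow k, hf.2.pow k⟩

lemma isHomSemi_polyGamma : IsHomSemi 1 1 6 polyGamma := ⟨polyGamma_isSemi, isHomogeneous_polyGamma⟩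

lemma isHomSemi_polyDelta : IsHomSemi (-1) 0 12 polyDelta :=
  ⟨polyDelta_isSemi, isHomogeneous_polyDelta⟩

lemma isHomSemi_C (c : ℂ) : IsHomSemi 1 0 0 (C c) :=
  ⟨by rw [pow_zero]; exact isSemi_C c, isHomogeneous_C _ _⟩

lemma IsHomCov.cast {a a' : ℂ} {n n' d d' : ℕ} {F : Fin 3 → Poly} (hF : IsHomCov a n d F)
    (ha : a = a') (hn : n % 4 = n' % 4) (hd : d = d') : IsHomCov a' n' d' F := by
  subst ha hd
  have : Complex.I ^ n = Complex.I ^ n' := by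
    conv_lhs => rw [← Nat.div_add_mod n 4, pow_add, pow_mul, Complex.I_pow_four, one_pow, hn]
    conv_rhs => rw [← Nat.div_add_mod n' 4, pow_add, pow_mul, Complex.I_pow_four, one_pow]
  exact ⟨this ▸ hF.1, hF.2⟩

lemma isHomCov_covId : IsHomCov 1 0 2 covId := ⟨covId_symCov, isHomogeneous_covId⟩

lemma isHomCov_covGammaSq : IsHomCov 1 0 10 covGammaSq :=
  ⟨covGammaSq_symCov, isHomogeneous_covGammaSq⟩

lemma isHomCov_covGammaTheta : IsHomCov 1 3 12 covGammaTheta :=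
  ⟨covGammaTheta_symCov, isHomogeneous_covGammaTheta⟩

lemma isHomCov_covIdGamma : IsHomCov (-1) 0 6 covIdGamma :=
  ⟨covIdGamma_symCov, isHomogeneous_covIdGamma⟩

lemma isHomCov_covIdTheta : IsHomCov (-1) 3 8 covIdTheta :=
  ⟨covIdTheta_symCov, isHomogeneous_covIdTheta⟩

lemma isHomCov_hessTheta : IsHomCov 1 2 6 hessTheta := ⟨hessTheta_symCov, isHomogeneous_hessTheta⟩

lemma isHomCov_hessDelta : IsHomCov (-1) 2 10 hessDelta :=
  ⟨hessDelta_symCov, isHomogeneous_hessDelta⟩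

lemma isHomCov_hessGamma : IsHomCov 1 3 4 hessGamma := ⟨hessGamma_symCov, isHomogeneous_hessGamma⟩

lemma colDet_smul (f g h : Poly) (u v w : Fin 3 → Poly) :
    colDet ![f • u, g • v, h • w] = f * g * h * colDet ![u, v, w] := by
  simp only [colDet, Matrix.det_fin_three, Matrix.of_apply, Matrix.cons_val_zero,
    Matrix.cons_val_one, Matrix.cons_val, Pi.smul_apply, smul_eq_mul]
  ring

/-- In each case a triple with a computed determinant is multiplied by powers of Γ and Δ, chosen so
that the three twists agree, the degrees become d, d+8, d+16, and the determinant acquires the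
exponents e_i, k_i. The first column is also scaled, by t over the constant of the triple, so any
constant can be prescribed. -/
lemma exists_homCov_colDet_eq {i : ℕ} (hi : 21 ≤ i) (hi' : i ≤ 28) (t : ℂ) :
    ∃ v : Fin 3 → Fin 3 → Poly, (∀ j, IsHomCov (signT i) (expD i) (genDegree i j) (v j)) ∧
      colDet v = C t * polyDelta ^ eTable i * polyGamma ^ kTable i := by
  have hG := isHomSemi_polyGamma
  have hD := isHomSemi_polyDelta
  have hC := fun c => isHomSemi_C c
  have hn : ∀ c : ℂ, c ≠ 0 → (C (t / c) * C c : Poly) = C t := fun c hc => by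
    rw [← C_mul, div_mul_cancel₀ t hc]
  -- Exponents of i matter only modulo 4, which lets factors Γ shift the twist cyclically.
  have key : ∀ {a a0 a1 a2 : ℂ} {n n0 n1 n2 d d0 d1 d2 : ℕ} {u v w : Fin 3 → Poly},
      IsHomCov a0 n0 d0 u → IsHomCov a1 n1 d1 v → IsHomCov a2 n2 d2 w →
      a0 = a → a1 = a → a2 = a → n0 % 4 = n % 4 → n1 % 4 = n % 4 → n2 % 4 = n % 4 →
      d0 = d → d1 = d + 8 → d2 = d + 16 →
      ∀ j : Fin 3, IsHomCov a n (d + 8 * (j : ℕ)) (![u, v, w] j) := by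
    intro a a0 a1 a2 n n0 n1 n2 d d0 d1 d2 u v w h0 h1 h2 e0 e1 e2 f0 f1 f2 g0 g1 g2 j
    fin_cases j
    · exact h0.cast e0 f0 g0
    · exact h1.cast e1 f1 g1
    · exact h2.cast e2 f2 g2
  interval_cases i <;> unfold genDegree
  · refine ⟨![C (t / 36) • covId, covGammaSq, polyGamma • covGammaTheta],
      key ((hC _).smul isHomCov_covId) isHomCov_covGammaSq
        (hG.smul isHomCov_covGammaTheta)
        ?_ ?_ ?_ ?_ ?_ ?_ ?_ ?_ ?_, ?_⟩
    any_goals norm_num [signT, expD, degTable]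
    -- The middle column is given the factor 1 so that the scaling rule applies to all three
    -- columns.
    rw [← one_smul Poly covGammaSq, colDet_smul, colDet_covId_covGammaSq_covGammaTheta,
      ← hn 36 (by norm_num), map_ofNat]
    simp only [eTable, kTable]
    ring
  · refine ⟨![C (t / 6) • hessTheta, (polyGamma ^ 2) • covId, (polyGamma ^ 2) • covGammaSq],
      key ((hC _).smul isHomCov_hessTheta) ((hG.pow 2).smul isHomCov_covId)
        ((hG.pow 2).smul isHomCov_covGammaSq)
        ?_ ?_ ?_ ?_ ?_ ?_ ?_ ?_ ?_, ?_⟩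
    any_goals norm_num [signT, expD, degTable]
    rw [colDet_smul, colDet_hessTheta, ← hn 6 (by norm_num), map_ofNat]
    simp only [eTable, kTable]
    ring
  · refine ⟨![(C (t / 36) * polyGamma) • covId, polyGamma • covGammaSq,
        (polyGamma ^ 2) • covGammaTheta],
      key (((hC _).mul hG).smul isHomCov_covId) (hG.smul isHomCov_covGammaSq)
        ((hG.pow 2).smul isHomCov_covGammaTheta)
        ?_ ?_ ?_ ?_ ?_ ?_ ?_ ?_ ?_, ?_⟩
    any_goals norm_num [signT, expD, degTable]
    rw [colDet_smul, colDet_covId_covGammaSq_covGammaTheta, ← hn 36 (by norm_num), map_ofNat]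
    simp only [eTable, kTable]
    ring
  · refine ⟨![C (t / 6) • hessGamma, covGammaTheta, (polyGamma ^ 3) • covId],
      key ((hC _).smul isHomCov_hessGamma) isHomCov_covGammaTheta
        ((hG.pow 3).smul isHomCov_covId)
        ?_ ?_ ?_ ?_ ?_ ?_ ?_ ?_ ?_, ?_⟩
    any_goals norm_num [signT, expD, degTable]
    rw [← one_smul Poly covGammaTheta, colDet_smul, colDet_hessGamma_covGammaTheta,
      ← hn 6 (by norm_num), map_ofNat]
    simp only [eTable, kTable]
    ring
  · refine ⟨![C (t / 108) • covIdGamma, polyDelta • covId, polyDelta • covGammaSq],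
      key ((hC _).smul isHomCov_covIdGamma) (hD.smul isHomCov_covId) (hD.smul isHomCov_covGammaSq)
        ?_ ?_ ?_ ?_ ?_ ?_ ?_ ?_ ?_, ?_⟩
    any_goals norm_num [signT, expD, degTable]
    rw [colDet_smul, colDet_covIdGamma_covId_covGammaSq, ← hn 108 (by norm_num), map_ofNat]
    simp only [eTable, kTable]
    ring
  · refine ⟨![C (t / 3) • hessDelta, (polyGamma ^ 2) • covIdGamma,
        (polyDelta * polyGamma ^ 2) • covId],
      key ((hC _).smul isHomCov_hessDelta) ((hG.pow 2).smul isHomCov_covIdGamma)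
        ((hD.mul (hG.pow 2)).smul isHomCov_covId)
        ?_ ?_ ?_ ?_ ?_ ?_ ?_ ?_ ?_, ?_⟩
    any_goals norm_num [signT, expD, degTable]
    rw [colDet_smul, colDet_hessDelta, ← hn 3 (by norm_num), map_ofNat]
    simp only [eTable, kTable]
    ring
  · refine ⟨![(C (t / 108) * polyGamma) • covIdGamma, (polyGamma * polyDelta) • covId,
        (polyGamma * polyDelta) • covGammaSq],
      key (((hC _).mul hG).smul isHomCov_covIdGamma) ((hG.mul hD).smul isHomCov_covId)
        ((hG.mul hD).smul isHomCov_covGammaSq)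
        ?_ ?_ ?_ ?_ ?_ ?_ ?_ ?_ ?_, ?_⟩
    any_goals norm_num [signT, expD, degTable]
    rw [colDet_smul, colDet_covIdGamma_covId_covGammaSq, ← hn 108 (by norm_num), map_ofNat]
    simp only [eTable, kTable]
    ring
  · refine ⟨![C (t / 6) • covIdTheta, polyDelta • hessGamma, (polyGamma ^ 3) • covIdGamma],
      key ((hC _).smul isHomCov_covIdTheta) (hD.smul isHomCov_hessGamma)
        ((hG.pow 3).smul isHomCov_covIdGamma)
        ?_ ?_ ?_ ?_ ?_ ?_ ?_ ?_ ?_, ?_⟩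
    any_goals norm_num [signT, expD, degTable]
    rw [colDet_smul, colDet_covIdTheta_hessGamma, ← hn 6 (by norm_num), map_ofNat]
    simp only [eTable, kTable]
    ring

/-! ### The determinant criterion for bases -/

lemma polyGamma_ne_zero : polyGamma ≠ 0 := by
  rw [polyGamma_eq, neg_ne_zero]
  have hq : quarticForm 1 ≠ 0 := fun h => by
    have := congrArg (eval ![(1 : ℂ), 0]) h
    simp [quarticForm] at this
  exact mul_ne_zero (mul_ne_zero (X_ne_zero _) (X_ne_zero _)) hq

lemma polyDelta_ne_zero : polyDelta ≠ 0 := fun h => by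
  have := congrArg (eval ![(1 : ℂ), 0]) h
  simp [polyDelta] at this

lemma polyDelta_mul_polyGamma_ne_zero {c : ℂ} (hc : c ≠ 0) (e k : ℕ) :
    C c * polyDelta ^ e * polyGamma ^ k ≠ 0 :=
  mul_ne_zero (mul_ne_zero (C_ne_zero.2 hc) (pow_ne_zero _ polyDelta_ne_zero))
    (pow_ne_zero _ polyGamma_ne_zero)

lemma linearIndependent_of_colDet_ne_zero {m : ℕ} {v : Fin m → Fin m → Poly} (h : colDet v ≠ 0) :
    LinearIndependent invRing v := by
  have h1 : LinearIndependent Poly v := by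
    have := Matrix.linearIndependent_cols_of_det_ne_zero h
    exact this
  refine h1.restrict_scalars ?_
  intro a b hab
  simpa [Subalgebra.smul_def] using hab

/-- By Cramer's rule the jth coefficient of F is the determinant with column j replaced by F,
divided by det v. The quotient is a polynomial by `hdvd`, and it is invariant because both
determinants have the character det ρ. -/
lemma mem_span_of_cramer {m : ℕ} {ρ : grp →* GL (Fin m) ℂ} {v : Fin m → Fin m → Poly}
    (hv : ∀ j, v j ∈ covModule ρ) (h0 : colDet v ≠ 0)
    (hdvd : ∀ w : Fin m → Fin m → Poly, (∀ j, w j ∈ covModule ρ) → colDet v ∣ colDet w)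
    {F : Fin m → Poly} (hF : F ∈ covModule ρ) : F ∈ Submodule.span invRing (Set.range v) := by
  have hw : ∀ j l, Function.update v j F l ∈ covModule ρ := fun j l => by
    rcases eq_or_ne l j with rfl | hl
    · rwa [Function.update_self]
    · rw [Function.update_of_ne hl]; exact hv l
  choose a ha using fun j => hdvd _ (hw j)
  have hinv : ∀ j, a j ∈ invRing := fun j σ => by
    have h1 := act_colDet (hw j) σ
    rw [ha j, map_mul, act_colDet hv σ, mul_assoc] at h1
    have hd : (C (ρ σ : Matrix (Fin m) (Fin m) ℂ).det : Poly) ≠ 0 :=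
      C_ne_zero.2 (Matrix.isUnits_det_units (ρ σ)).ne_zero
    exact mul_left_cancel₀ h0 (mul_left_cancel₀ hd h1)
  rw [Submodule.mem_span_range_iff_exists_fun]
  refine ⟨fun j => ⟨a j, hinv j⟩, ?_⟩
  ext1 r
  refine mul_left_cancel₀ h0 ?_
  have hc := congrFun (Matrix.mulVec_cramer (Matrix.of fun r j => v j r) F) r
  have hcr : ∀ j, Matrix.cramer (Matrix.of fun r j => v j r) F j = colDet v * a j := fun j => by
    rw [← ha j, Matrix.cramer_apply, colDet]
    congr 1
    ext1 s l
    rcases eq_or_ne l j with rfl | hl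
    · simp
    · simp [Matrix.updateCol_ne hl, Function.update_of_ne hl]
  simp only [Matrix.mulVec, dotProduct, hcr, Matrix.of_apply, Pi.smul_apply, smul_eq_mul] at hc
  rw [show colDet v * F r = (Matrix.of fun r j => v j r).det * F r from rfl, ← hc]
  simp only [Finset.sum_apply, Pi.smul_apply, Subalgebra.smul_def, smul_eq_mul, Finset.mul_sum]
  exact Finset.sum_congr rfl fun j _ => by ring

/-- A determinant of minimal form divides the determinant of every triple of covariants, which is
what Cramer's rule needs. -/
lemma isHomogeneousBasis_of_colDet {i : ℕ} (hi : 21 ≤ i) (hi' : i ≤ 28)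
    {v : Fin 3 → Fin 3 → Poly} {d : Fin 3 → ℕ} (hv : ∀ j, v j ∈ covModule (rho i))
    (hd : ∀ j r, (v j r).IsHomogeneous (d j)) {c : ℂ} (hc : c ≠ 0)
    (hdet : colDet v = C c * polyDelta ^ eTable i * polyGamma ^ kTable i) :
    IsHomogeneousBasis (rho i) d v := by
  have h0 : colDet v ≠ 0 := hdet ▸ polyDelta_mul_polyGamma_ne_zero hc _ _
  refine ⟨linearIndependent_of_colDet_ne_zero h0, le_antisymm ?_ ?_, hd⟩
  · rw [Submodule.span_le]
    rintro _ ⟨j, rfl⟩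
    exact hv j
  · intro F hF
    refine mem_span_of_cramer hv h0 (fun w hw => ?_) hF
    rw [hdet, mul_assoc]
    exact ((hc.isUnit.map (C : ℂ →+* Poly)).mul_left_dvd).2
      (polyDelta_mul_polyGamma_dvd_colDet hi hi' hw)

lemma exists_isHomogeneousBasis {i : ℕ} (hi : 21 ≤ i) (hi' : i ≤ 28) {c : ℂ} (hc : c ≠ 0) :
    ∃ v : Fin 3 → Fin 3 → Poly, IsHomogeneousBasis (rho i) (genDegree i) v ∧
      colDet v = C c * polyDelta ^ eTable i * polyGamma ^ kTable i := by
  obtain ⟨v, hv, hdet⟩ := exists_homCov_colDet_eq hi hi' c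
  exact ⟨v, isHomogeneousBasis_of_colDet hi hi'
    (fun j => (mem_covModule_rho_iff_symCov hi hi').2 (hv j).1) (fun j => (hv j).2) hc hdet, hdet⟩

lemma IsHomogeneousBasis.mem {m n : ℕ} {ρ : grp →* GL (Fin m) ℂ} {d : Fin n → ℕ}
    {v : Fin n → Fin m → Poly} (h : IsHomogeneousBasis ρ d v) (j : Fin n) : v j ∈ covModule ρ := by
  rw [← h.span_eq]
  exact Submodule.subset_span ⟨j, rfl⟩

lemma IsHomogeneousBasis.exists_coeff {m n : ℕ} {ρ : grp →* GL (Fin m) ℂ} {d : Fin n → ℕ}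
    {v : Fin n → Fin m → Poly} (h : IsHomogeneousBasis ρ d v) {F : Fin m → Poly}
    (hF : F ∈ covModule ρ) : ∃ a : Fin n → invRing, ∀ r, F r = ∑ j, (a j : Poly) * v j r := by
  rw [← h.span_eq, Submodule.mem_span_range_iff_exists_fun] at hF
  obtain ⟨a, ha⟩ := hF
  refine ⟨a, fun r => ?_⟩
  rw [← ha]
  simp [Finset.sum_apply, Subalgebra.smul_def]

/-- The quotient is the determinant of the matrix of coefficients of w in the basis v. -/
lemma IsHomogeneousBasis.colDet_dvd {m : ℕ} {ρ : grp →* GL (Fin m) ℂ} {d : Fin m → ℕ}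
    {v : Fin m → Fin m → Poly} (h : IsHomogeneousBasis ρ d v) {w : Fin m → Fin m → Poly}
    (hw : ∀ j, w j ∈ covModule ρ) : colDet v ∣ colDet w := by
  choose a ha using fun l => h.exists_coeff (hw l)
  refine ⟨(Matrix.of fun j l => (a l j : Poly)).det, ?_⟩
  rw [colDet, colDet, ← Matrix.det_mul]
  congr 1
  ext1 r l
  simp only [Matrix.of_apply, Matrix.mul_apply]
  rw [ha l r]
  exact Finset.sum_congr rfl fun j _ => mul_comm _ _

/-- The determinants of two bases divide each other, so they differ by a unit of ℂ[x, y], a nonzero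
constant. The comparison is with the explicit basis. -/
lemma IsHomogeneousBasis.exists_colDet_eq {i : ℕ} (hi : 21 ≤ i) (hi' : i ≤ 28) {d : Fin 3 → ℕ}
    {v : Fin 3 → Fin 3 → Poly} (h : IsHomogeneousBasis (rho i) d v) :
    ∃ c : ℂ, c ≠ 0 ∧ colDet v = C c * polyDelta ^ eTable i * polyGamma ^ kTable i := by
  obtain ⟨w, hw, hdet⟩ := exists_isHomogeneousBasis hi hi' one_ne_zero
  have h0 := polyDelta_mul_polyGamma_ne_zero one_ne_zero (eTable i) (kTable i)
  rw [← hdet] at h0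
  obtain ⟨p, hp⟩ := hw.colDet_dvd h.mem
  obtain ⟨q, hq⟩ := h.colDet_dvd hw.mem
  have hpq : p * q = 1 := mul_left_cancel₀ h0 (by rw [← mul_assoc, ← hp, ← hq, mul_one])
  obtain ⟨c, hc, rfl⟩ := isUnit_iff_eq_C_of_isReduced.1 (IsUnit.of_mul_eq_one q hpq)
  refine ⟨c, hc.ne_zero, ?_⟩
  rw [hp, hdet, C_1]
  ring

/-! ### The invariant ring -/

lemma homogeneousComponent_mul_of_isHomogeneous {q : Poly} {d : ℕ} (hq : q.IsHomogeneous d)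
    (n : ℕ) (p : Poly) : homogeneousComponent n (p * q) =
      if d ≤ n then homogeneousComponent (n - d) p * q else 0 := by
  conv_lhs => rw [← sum_homogeneousComponent p, Finset.sum_mul, map_sum]
  have h : ∀ m ∈ Finset.range (p.totalDegree + 1),
      homogeneousComponent n (homogeneousComponent m p * q) =
        if m + d = n then homogeneousComponent m p * q else 0 := fun m _ => by
    rw [homogeneousComponent_of_mem ((homogeneousComponent_isHomogeneous m p).mul hq)]
    simp only [eq_comm]
  rw [Finset.sum_congr rfl h]
  split_ifs with hd
  · have h' : ∀ m, (m + d = n) ↔ (m = n - d) := fun m => by omega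
    simp only [h', Finset.sum_ite_eq']
    split_ifs with hn
    · rfl
    · rw [homogeneousComponent_eq_zero _ p (by rw [Finset.mem_range] at hn; omega), zero_mul]
  · exact Finset.sum_eq_zero fun m _ => if_neg (by omega)

lemma homogeneousComponent_mem_invRing {f : Poly} (hf : f ∈ invRing) (n : ℕ) :
    homogeneousComponent n f ∈ invRing := fun σ => by
  rw [← homogeneousComponent_act, hf σ]

/-- The space of homogeneous invariants of degree `n`. -/
def invDegree (n : ℕ) : Submodule ℂ Poly :=
  Subalgebra.toSubmodule invRing ⊓ homogeneousSubmodule (Fin 2) ℂ n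

lemma mem_invDegree {n : ℕ} {f : Poly} : f ∈ invDegree n ↔ f ∈ invRing ∧ f.IsHomogeneous n :=
  Iff.rfl

/-- This scalar is the primitive eighth root of unity (1+i)/√2; its presence in the group restricts
the degrees of invariants to multiples of 8. -/
lemma matT_mul_matD_pow_three : (matT * matD) ^ 3 =
    (((Real.sqrt 2 : ℝ) : ℂ)⁻¹ * (1 + Complex.I)) • (1 : Matrix (Fin 2) (Fin 2) ℂ) := by
  have h := sqrt_two_inv_sq
  have hI := Complex.I_sq
  generalize hs : ((Real.sqrt 2 : ℝ) : ℂ)⁻¹ = s at *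
  have hT : matT * matD = !![s, s * Complex.I; s, -(s * Complex.I)] := by
    rw [matT, hs, matD]
    ext i j
    fin_cases i <;> fin_cases j <;> simp
  rw [hT, pow_three]
  generalize Complex.I = u at *
  ext i j
  fin_cases i <;> fin_cases j <;> simp
  · linear_combination 2 * s * (1 + u) * h - s ^ 3 * hI
  · linear_combination s ^ 3 * u * hI
  · linear_combination s ^ 3 * hI
  · linear_combination 2 * s * (1 + u) * h - s ^ 3 * (u + 2) * hI

lemma act_smul_one {f : Poly} {n : ℕ} (hf : f.IsHomogeneous n) (z : ℂ) :
    act (z • 1) f = C (z ^ n) * f := by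
  have hX : ∀ i : Fin 2, act (z • 1) (X i) = C z * X i := fun i => by
    fin_cases i <;> simp [act]
  have hm : ∀ s : Fin 2 →₀ ℕ, s.degree = n → ∀ c : ℂ,
      act (z • 1) (monomial s c) = C (z ^ n) * monomial s c := fun s hs c => by
    rw [Finsupp.degree_eq_sum, Fin.sum_univ_two] at hs
    rw [monomial_eq, Finsupp.prod_fintype _ _ (fun i => pow_zero _), Fin.prod_univ_two]
    simp only [map_mul, map_pow, act_C, hX, mul_pow, ← hs, pow_add]
    ring
  conv_lhs => rw [f.as_sum]
  conv_rhs => rw [f.as_sum]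
  rw [map_sum, Finset.mul_sum]
  refine Finset.sum_congr rfl fun s hs => hm s ?_ _
  by_contra h
  exact (mem_support_iff.1 hs) (hf.coeff_eq_zero h)

lemma eight_dvd_of_mem_invDegree {n : ℕ} {f : Poly} (hf : f ∈ invDegree n) (h0 : f ≠ 0) :
    8 ∣ n := by
  have hI := Complex.I_sq
  have h := sqrt_two_inv_sq
  have hs := mem_invRing_iff.1 hf.1
  have hT : act matT f = f := by rw [hs.1, C_1, one_mul]
  have hD : act matD f = f := by rw [hs.2, C_1, one_mul]
  have h1 : act ((matT * matD) ^ 3) f = f := by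
    simp only [pow_three, ← act_act, hT, hD]
  rw [matT_mul_matD_pow_three, act_smul_one hf.2] at h1
  generalize hz : ((Real.sqrt 2 : ℝ) : ℂ)⁻¹ * (1 + Complex.I) = z at *
  -- From z⁴ = -1 the order of z is exactly 8.
  have hz4 : z ^ 2 ^ 2 = -1 := by
    rw [← hz]
    generalize ((Real.sqrt 2 : ℝ) : ℂ)⁻¹ = s at *
    generalize Complex.I = u at *
    have : s ^ 4 = 1 / 4 := by linear_combination (s ^ 2 + 1 / 2) * h
    norm_num [mul_pow, this]
    linear_combination (u ^ 2 + 4 * u + 5) / 4 * hI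
  have hz1 : z ^ n = 1 := by
    have : C (z ^ n - 1) * f = 0 := by rw [map_sub, sub_mul, h1, C_1, one_mul, sub_self]
    have := C_eq_zero.1 ((mul_eq_zero.1 this).resolve_right h0)
    exact sub_eq_zero.1 this
  have ho : orderOf z = 2 ^ (2 + 1) := by
    have : Fact (Nat.Prime 2) := ⟨Nat.prime_two⟩
    refine orderOf_eq_prime_pow ?_ ?_
    · rw [hz4]; norm_num
    · rw [pow_succ, pow_mul, hz4]; norm_num
  have := orderOf_dvd_of_pow_eq_one hz1
  rw [ho] at this
  simpa using this

lemma polyTheta_mem_invRing : polyTheta ∈ invRing := mem_invRing_iff.2 polyTheta_isSemi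

lemma polyGamma_pow_four_mem_invRing : polyGamma ^ 4 ∈ invRing := by
  have := polyGamma_isSemi.pow 4
  rw [one_pow, pow_one, Complex.I_pow_four] at this
  exact mem_invRing_iff.2 this

/-- This trades φ for Γ⁴, which vanishes on y = 0 and so suits the division argument. -/
lemma polyPhi_eq : polyPhi = polyTheta ^ 3 - 42 * polyGamma ^ 4 := by
  simp only [polyPhi, polyTheta, polyGamma]; ring

lemma polyPhi_mem_invRing : polyPhi ∈ invRing := by
  rw [polyPhi_eq]
  exact invRing.sub_mem (invRing.pow_mem polyTheta_mem_invRing 3)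
    (invRing.mul_mem (ofNat_mem invRing 42) polyGamma_pow_four_mem_invRing)

lemma polyTheta_pow_mul_polyPhi_pow_mem_invDegree (a b : ℕ) :
    polyTheta ^ a * polyPhi ^ b ∈ invDegree (8 * a + 24 * b) :=
  ⟨invRing.mul_mem (invRing.pow_mem polyTheta_mem_invRing a)
    (invRing.pow_mem polyPhi_mem_invRing b),
    (isHomogeneous_polyTheta.pow a).mul (isHomogeneous_polyPhi.pow b)⟩

lemma restrictAxis_polyTheta : restrictAxis polyTheta = X 0 ^ 8 := by
  simp [polyTheta, restrictAxis]

lemma restrictAxis_polyGamma : restrictAxis polyGamma = 0 := by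
  simp [polyGamma, restrictAxis]

lemma restrictAxis_eq_of_isHomogeneous {f : Poly} {n : ℕ} (hf : f.IsHomogeneous n) :
    ∃ c : ℂ, restrictAxis f = C c * X 0 ^ n := by
  have hm : ∀ s : Fin 2 →₀ ℕ, s.degree = n → ∀ c : ℂ,
      ∃ c' : ℂ, restrictAxis (monomial s c) = C c' * X 0 ^ n := fun s hs c => by
    rw [Finsupp.degree_eq_sum, Fin.sum_univ_two] at hs
    rw [monomial_eq, Finsupp.prod_fintype _ _ (fun i => pow_zero _), Fin.prod_univ_two]
    simp only [map_mul, map_pow, restrictAxis, aeval_X, Matrix.cons_val_zero, Matrix.cons_val_one,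
      algHom_C, algebraMap_eq]
    rcases Nat.eq_zero_or_pos (s 1) with h | h
    · exact ⟨c, by rw [h] at hs ⊢; rw [← hs]; simp⟩
    · exact ⟨0, by rw [zero_pow h.ne']; simp⟩
  have h : ∀ s ∈ f.support, ∃ c' : ℂ,
      restrictAxis (monomial s (coeff s f)) = C c' * X 0 ^ n := fun s hs => by
    refine hm s ?_ _
    by_contra h
    exact (mem_support_iff.1 hs) (hf.coeff_eq_zero h)
  choose! c hc using h
  refine ⟨∑ s ∈ f.support, c s, ?_⟩
  conv_lhs => rw [f.as_sum, map_sum, Finset.sum_congr rfl hc]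
  rw [map_sum, Finset.sum_mul]

/-- If f = yg is D-invariant, then g has D-eigenvalue i⁻¹ = i³ and is divisible by y³. So y⁴ divides
f, hence Γ⁴ does. A nonzero f therefore has degree at least 24. -/
lemma exists_mul_polyGamma_pow_four {n : ℕ} {f : Poly} (hf : f ∈ invDegree n)
    (h : restrictAxis f = 0) : f = 0 ∨ 24 ≤ n ∧ ∃ g ∈ invDegree (n - 24), f = g * polyGamma ^ 4 := by
  have hs := mem_invRing_iff.1 hf.1
  have hI := Complex.I_ne_zero
  have h4 : X 1 ^ 4 ∣ f := by
    obtain ⟨g, rfl⟩ := X_one_dvd_of_restrictAxis_eq_zero h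
    rw [pow_succ']
    refine mul_dvd_mul_left _ (X_one_pow_dvd_of_act_matD (by norm_num) ?_)
    refine mul_left_cancel₀ (mul_ne_zero (C_ne_zero.2 hI) (X_ne_zero (1 : Fin 2))) ?_
    have := hs.2
    rw [map_mul, act_matD_X1] at this
    rw [this, show C Complex.I * X 1 * (C (Complex.I ^ 3) * g) = C (Complex.I ^ 4) * (X 1 * g) by
      rw [pow_succ _ 3, C_mul]; ring, Complex.I_pow_four]
  obtain ⟨g, rfl⟩ := polyGamma_pow_dvd one_ne_zero one_ne_zero hs h4
  have hG : (polyGamma ^ 4).IsHomogeneous 24 := isHomogeneous_polyGamma.pow 4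
  -- Comparing components of degree n replaces the cofactor by its homogeneous component of degree n
  -- - 24.
  have hfn := homogeneousComponent_eq_self (hf.2 : (polyGamma ^ 4 * g).IsHomogeneous n)
  rw [mul_comm, homogeneousComponent_mul_of_isHomogeneous hG] at hfn
  split_ifs at hfn with hn
  · refine Or.inr ⟨hn, homogeneousComponent (n - 24) g,
      mem_invDegree.2 ⟨homogeneousComponent_mem_invRing ?_ _,
        homogeneousComponent_isHomogeneous _ _⟩, ?_⟩
    · have hG4 := mem_invRing_iff.1 polyGamma_pow_four_mem_invRing
      refine mem_invRing_iff.2 (hG4.of_mul one_ne_zero one_ne_zero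
        (pow_ne_zero 4 polyGamma_ne_zero) ?_)
      rw [mul_one]
      exact hs
    · rw [hfn, mul_comm]
  · left
    rw [mul_comm, ← hfn]

/-- On y = 0 an invariant of degree 8n is a multiple of x⁸ⁿ, the restriction of θⁿ. The difference
vanishes there and is a multiple of Γ⁴. -/
lemma exists_eq_polyTheta_pow_add {n : ℕ} {f : Poly} (hf : f ∈ invDegree (8 * n)) :
    ∃ c : ℂ, f = C c * polyTheta ^ n ∨
      3 ≤ n ∧ ∃ g ∈ invDegree (8 * (n - 3)), f = C c * polyTheta ^ n + g * polyGamma ^ 4 := by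
  obtain ⟨c, hc⟩ := restrictAxis_eq_of_isHomogeneous hf.2
  refine ⟨c, ?_⟩
  have hth : C c * polyTheta ^ n ∈ invDegree (8 * n) := by
    rw [← smul_eq_C_mul]
    refine Submodule.smul_mem _ _ ?_
    simpa using polyTheta_pow_mul_polyPhi_pow_mem_invDegree n 0
  have h0 : restrictAxis (f - C c * polyTheta ^ n) = 0 := by
    rw [map_sub, hc, map_mul, map_pow, restrictAxis_polyTheta, ← pow_mul,
      show restrictAxis (C c) = C c from restrictAxis.commutes _, sub_self]
  rcases exists_mul_polyGamma_pow_four (Submodule.sub_mem _ hf hth) h0 with h | ⟨hn, g, hg, h⟩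
  · exact Or.inl (sub_eq_zero.1 h)
  · refine Or.inr ⟨by omega, g, ?_, ?_⟩
    · rwa [show 8 * (n - 3) = 8 * n - 24 by omega]
    · rw [← h]; ring

lemma invDegree_eq_bot {n : ℕ} (h : ¬ 8 ∣ n) : invDegree n = ⊥ := by
  rw [Submodule.eq_bot_iff]
  intro f hf
  by_contra h0
  exact h (eight_dvd_of_mem_invDegree hf h0)

/-- Induction in steps of three on the degree over 8, using Γ⁴ = (θ³ - φ)/42 to rewrite the Γ⁴-part
of the decomposition. -/
lemma invDegree_le_span (n : ℕ) : invDegree n ≤ Submodule.span ℂ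
    {f | ∃ a b : ℕ, n = 8 * a + 24 * b ∧ f = polyTheta ^ a * polyPhi ^ b} := by
  by_cases h8 : 8 ∣ n
  swap
  · rw [invDegree_eq_bot h8]; exact bot_le
  obtain ⟨n, rfl⟩ := h8
  induction n using Nat.strong_induction_on with
  | _ n ih =>
    intro f hf
    have hth : ∀ c : ℂ, C c * polyTheta ^ n ∈ Submodule.span ℂ
        {f | ∃ a b : ℕ, 8 * n = 8 * a + 24 * b ∧ f = polyTheta ^ a * polyPhi ^ b} := fun c => by
      rw [← smul_eq_C_mul]
      exact Submodule.smul_mem _ _ (Submodule.subset_span ⟨n, 0, by simp, by simp⟩)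
    obtain ⟨c, rfl | ⟨hn, g, hg, rfl⟩⟩ := exists_eq_polyTheta_pow_add hf
    · exact hth c
    · refine Submodule.add_mem _ (hth c) ?_
      have hg' := ih (n - 3) (by omega) hg
      clear hf hg
      induction hg' using Submodule.span_induction with
      | mem g hg =>
        obtain ⟨a, b, hab, rfl⟩ := hg
        have h42 : (C (1 / 42) : Poly) * 42 = 1 := by
          rw [← map_ofNat C 42, ← C_mul]; norm_num
        have : polyTheta ^ a * polyPhi ^ b * polyGamma ^ 4 =
            (1 / 42 : ℂ) • (polyTheta ^ (a + 3) * polyPhi ^ b) -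
              (1 / 42 : ℂ) • (polyTheta ^ a * polyPhi ^ (b + 1)) := by
          rw [smul_eq_C_mul, smul_eq_C_mul, pow_succ polyPhi b]
          linear_combination (-polyTheta ^ a * polyPhi ^ b * polyGamma ^ 4) * h42 +
            C (1 / 42) * polyTheta ^ a * polyPhi ^ b * polyPhi_eq
        rw [this]
        exact Submodule.sub_mem _
          (Submodule.smul_mem _ _ (Submodule.subset_span ⟨a + 3, b, by omega, rfl⟩))
          (Submodule.smul_mem _ _ (Submodule.subset_span ⟨a, b + 1, by omega, rfl⟩))
      | zero => rw [zero_mul]; exact Submodule.zero_mem _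
      | add p q _ _ hp hq => rw [add_mul]; exact Submodule.add_mem _ hp hq
      | smul a p _ hp => rw [smul_mul_assoc]; exact Submodule.smul_mem _ a hp

instance finite_invDegree (n : ℕ) : Module.Finite ℂ (invDegree n) := by
  have : Module.Finite ℂ (homogeneousSubmodule (Fin 2) ℂ n) :=
    Module.Finite.iff_fg.2 (homogeneousSubmodule_fg (σ := Fin 2) (R := ℂ) n)
  exact Submodule.finiteDimensional_of_le (inf_le_right : invDegree n ≤ _)

lemma polyTheta_pow_mul_eq_zero {c : ℂ} {n : ℕ} {g : Poly}
    (h : C c * polyTheta ^ n + g * polyGamma ^ 4 = 0) : c = 0 ∧ g = 0 := by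
  have h1 := congrArg restrictAxis h
  rw [map_add, map_mul, map_mul, map_pow, map_pow, restrictAxis_polyTheta, restrictAxis_polyGamma,
    show restrictAxis (C c) = C c from restrictAxis.commutes _] at h1
  have hc : c = 0 := by simpa using h1
  refine ⟨hc, ?_⟩
  rw [hc, C_0, zero_mul, zero_add] at h
  exact (mul_eq_zero.1 h).resolve_right (pow_ne_zero 4 polyGamma_ne_zero)

/-- The invariants of degree 8(n+3) are the direct sum of ℂθⁿ⁺³ and Γ⁴ times the invariants of
degree 8n; the sum is direct because Γ vanishes on y = 0 and θ does not. -/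
lemma finrank_invDegree_add_three (n : ℕ) : Module.finrank ℂ (invDegree (8 * (n + 3))) =
    1 + Module.finrank ℂ (invDegree (8 * n)) := by
  let φ : (ℂ × invDegree (8 * n)) →ₗ[ℂ] Poly :=
    { toFun := fun p => C p.1 * polyTheta ^ (n + 3) + (p.2 : Poly) * polyGamma ^ 4
      map_add' := fun p q => by simp only [Prod.fst_add, Prod.snd_add, Submodule.coe_add, C_add]; ring
      map_smul' := fun c p => by
        simp only [Prod.smul_fst, Prod.smul_snd, Submodule.coe_smul, smul_eq_mul, C_mul,
          smul_eq_C_mul, RingHom.id_apply]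
        ring }
  have hinj : Function.Injective φ := by
    rw [← LinearMap.ker_eq_bot, LinearMap.ker_eq_bot']
    rintro ⟨c, g⟩ h
    have h' : C c * polyTheta ^ (n + 3) + (g : Poly) * polyGamma ^ 4 = 0 := h
    obtain ⟨h1, h2⟩ := polyTheta_pow_mul_eq_zero h'
    exact Prod.ext h1 (Subtype.ext h2)
  have hrange : LinearMap.range φ = invDegree (8 * (n + 3)) := by
    apply le_antisymm
    · rintro _ ⟨⟨c, g⟩, rfl⟩
      refine Submodule.add_mem _ ?_ ?_
      · rw [← smul_eq_C_mul]
        refine Submodule.smul_mem _ _ ?_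
        simpa using polyTheta_pow_mul_polyPhi_pow_mem_invDegree (n + 3) 0
      · obtain ⟨g, hg⟩ := g
        rw [mem_invDegree] at hg ⊢
        exact ⟨invRing.mul_mem hg.1 polyGamma_pow_four_mem_invRing,
          hg.2.mul (isHomogeneous_polyGamma.pow 4)⟩
    · intro f hf
      obtain ⟨c, rfl | ⟨_, g, hg, rfl⟩⟩ := exists_eq_polyTheta_pow_add hf
      · exact ⟨(c, 0), by simp [φ]⟩
      · exact ⟨(c, ⟨g, hg⟩), rfl⟩
  rw [← hrange, LinearMap.finrank_range_of_inj hinj, Module.finrank_prod, Module.finrank_self]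

lemma finrank_invDegree_of_lt_three {n : ℕ} (hn : n < 3) :
    Module.finrank ℂ (invDegree (8 * n)) = 1 := by
  have h0 : polyTheta ≠ 0 := fun h => by
    have := restrictAxis_polyTheta
    rw [h, map_zero] at this
    exact pow_ne_zero 8 (X_ne_zero (0 : Fin 2)) this.symm
  have : invDegree (8 * n) = Submodule.span ℂ {polyTheta ^ n} := by
    apply le_antisymm
    · intro f hf
      obtain ⟨c, rfl | ⟨h3, _⟩⟩ := exists_eq_polyTheta_pow_add hf
      · exact Submodule.mem_span_singleton.2 ⟨c, smul_eq_C_mul _ _⟩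
      · omega
    · rw [Submodule.span_le, Set.singleton_subset_iff]
      simpa using polyTheta_pow_mul_polyPhi_pow_mem_invDegree n 0
  rw [this, finrank_span_singleton (pow_ne_zero n h0)]

lemma finrank_invDegree (n : ℕ) :
    Module.finrank ℂ (invDegree n) = if n % 8 = 0 then n / 24 + 1 else 0 := by
  split_ifs with h
  · obtain ⟨n, rfl⟩ := Nat.dvd_of_mod_eq_zero h
    induction n using Nat.strong_induction_on with
    | _ n ih =>
      by_cases hn : n < 3
      · rw [finrank_invDegree_of_lt_three hn]; omega
      · obtain ⟨k, rfl⟩ := Nat.exists_eq_add_of_le' (not_lt.1 hn)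
        rw [finrank_invDegree_add_three, ih k (by omega) (by omega)]
        omega
  · rw [invDegree_eq_bot (by omega), finrank_bot]

/-! ### Homogeneous components of the module of covariants -/

/-- The homogeneous invariants of degree `k - d`, or zero if `k < d`. -/
def shiftedInvDegree (d k : ℕ) : Submodule ℂ Poly := if d ≤ k then invDegree (k - d) else ⊥

instance finite_shiftedInvDegree (d k : ℕ) : Module.Finite ℂ (shiftedInvDegree d k) := by
  unfold shiftedInvDegree
  by_cases h : d ≤ k
  · rw [if_pos h]; infer_instance
  · rw [if_neg h]; infer_instance

lemma finrank_shiftedInvDegree (d k : ℕ) : Module.finrank ℂ (shiftedInvDegree d k) =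
    if d ≤ k ∧ (k - d) % 8 = 0 then (k - d) / 24 + 1 else 0 := by
  unfold shiftedInvDegree
  by_cases h : d ≤ k
  · rw [if_pos h, finrank_invDegree]; simp [h]
  · rw [if_neg h, finrank_bot, if_neg (fun h' => h h'.1)]

lemma mem_invRing_of_mem_shiftedInvDegree {d k : ℕ} {f : Poly} (hf : f ∈ shiftedInvDegree d k) :
    f ∈ invRing := by
  unfold shiftedInvDegree at hf
  split_ifs at hf
  · exact hf.1
  · rw [(Submodule.mem_bot ℂ).1 hf]; exact invRing.zero_mem

lemma smul_mem_covModule {m : ℕ} {ρ : grp →* GL (Fin m) ℂ} {f : Poly} (hf : f ∈ invRing)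
    {F : Fin m → Poly} (hF : F ∈ covModule ρ) : f • F ∈ covModule ρ :=
  (covModule ρ).smul_mem (⟨f, hf⟩ : invRing) hF

lemma smul_mem_covDegree {m : ℕ} {ρ : grp →* GL (Fin m) ℂ} {f : Poly} {n d : ℕ}
    (hf : f ∈ invDegree n) {F : Fin m → Poly} (hF : F ∈ covModule ρ)
    (hd : ∀ r, (F r).IsHomogeneous d) : f • F ∈ covDegree ρ (d + n) :=
  ⟨smul_mem_covModule hf.1 hF, fun r => by
    rw [add_comm]; exact (mem_invDegree.1 hf).2.mul (hd r)⟩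

lemma smul_mem_covDegree_of_mem_shiftedInvDegree {m : ℕ} {ρ : grp →* GL (Fin m) ℂ} {f : Poly}
    {k d : ℕ} (hf : f ∈ shiftedInvDegree d k) {F : Fin m → Poly} (hF : F ∈ covModule ρ)
    (hd : ∀ r, (F r).IsHomogeneous d) : f • F ∈ covDegree ρ k := by
  unfold shiftedInvDegree at hf
  split_ifs at hf with h
  · have := smul_mem_covDegree hf hF hd
    rwa [Nat.add_sub_cancel' h] at this
  · rw [(Submodule.mem_bot ℂ).1 hf, zero_smul]
    exact Submodule.zero_mem _

namespace IsHomogeneousBasis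

variable {m n : ℕ} {ρ : grp →* GL (Fin m) ℂ} {d : Fin n → ℕ} {v : Fin n → Fin m → Poly}

/-- Each coefficient may be replaced by its component of degree k - d j. The case d j > k is
separated because natural subtraction truncates. -/
lemma exists_homogeneous_coeff (h : IsHomogeneousBasis ρ d v) {k : ℕ} {F : Fin m → Poly}
    (hF : F ∈ covDegree ρ k) :
    ∃ a : Fin n → Poly, (∀ j, a j ∈ shiftedInvDegree (d j) k) ∧ F = ∑ j, a j • v j := by
  obtain ⟨a, ha⟩ := h.exists_coeff hF.1
  refine ⟨fun j => if d j ≤ k then homogeneousComponent (k - d j) (a j : Poly) else 0,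
    fun j => ?_, ?_⟩
  · by_cases hd : d j ≤ k
    · simp only [shiftedInvDegree, if_pos hd]
      exact mem_invDegree.2 ⟨homogeneousComponent_mem_invRing (a j).2 _,
        homogeneousComponent_isHomogeneous _ _⟩
    · simp only [if_neg hd]
      exact Submodule.zero_mem _
  · ext1 r
    rw [← homogeneousComponent_eq_self (hF.2 r), ha r, map_sum, Finset.sum_apply]
    refine Finset.sum_congr rfl fun j _ => ?_
    rw [homogeneousComponent_mul_of_isHomogeneous (h.homogeneous j r), Pi.smul_apply, smul_eq_mul,
      ite_mul, zero_mul]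

/-- The map `(aⱼ) ↦ ∑ aⱼ vⱼ` on tuples of homogeneous invariants of the complementary degrees. -/
def combination (v : Fin n → Fin m → Poly) (d : Fin n → ℕ) (k : ℕ) :
    (∀ j, shiftedInvDegree (d j) k) →ₗ[ℂ] (Fin m → Poly) where
  toFun a := ∑ j, (a j : Poly) • v j
  map_add' a b := by
    simp only [Pi.add_apply, Submodule.coe_add, add_smul, Finset.sum_add_distrib]
  map_smul' c a := by
    simp only [Pi.smul_apply, Submodule.coe_smul, smul_assoc, Finset.smul_sum, RingHom.id_apply]

lemma combination_injective (h : IsHomogeneousBasis ρ d v) (k : ℕ) :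
    Function.Injective (combination v d k) := by
  rw [← LinearMap.ker_eq_bot, LinearMap.ker_eq_bot']
  intro a ha
  have hz := Fintype.linearIndependent_iff.1 h.linearIndependent
    (fun j => ⟨a j, mem_invRing_of_mem_shiftedInvDegree (a j).2⟩) ha
  funext j
  exact Subtype.ext (show (a j : Poly) = 0 from congrArg Subtype.val (hz j))

lemma range_combination (h : IsHomogeneousBasis ρ d v) (k : ℕ) :
    LinearMap.range (combination v d k) = covDegree ρ k := by
  apply le_antisymm
  · rintro _ ⟨a, rfl⟩
    exact Submodule.sum_mem _ fun j _ =>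
      smul_mem_covDegree_of_mem_shiftedInvDegree (a j).2 (h.mem j) (h.homogeneous j)
  · intro F hF
    obtain ⟨a, ha, rfl⟩ := h.exists_homogeneous_coeff hF
    exact ⟨fun j => ⟨a j, ha j⟩, rfl⟩

lemma finite_covDegree (h : IsHomogeneousBasis ρ d v) (k : ℕ) :
    Module.Finite ℂ (covDegree ρ k) := by
  rw [← h.range_combination k]
  infer_instance

lemma finrank_covDegree (h : IsHomogeneousBasis ρ d v) (k : ℕ) :
    Module.finrank ℂ (covDegree ρ k) =
      ∑ j, if d j ≤ k ∧ (k - d j) % 8 = 0 then (k - d j) / 24 + 1 else 0 := by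
  rw [← h.range_combination k, LinearMap.finrank_range_of_inj (h.combination_injective k),
    Module.finrank_pi_fintype]
  exact Finset.sum_congr rfl fun j _ => finrank_shiftedInvDegree _ _

/-- Homogeneous coefficients in the basis are combinations of monomials in θ and φ of the
complementary degree. -/
lemma covDegree_eq_span (h : IsHomogeneousBasis ρ d v) (k : ℕ) :
    covDegree ρ k = Submodule.span ℂ {F | ∃ (α β : ℕ) (j : Fin n),
      k = d j + 8 * α + 24 * β ∧ F = (polyTheta ^ α * polyPhi ^ β) • v j} := by
  apply le_antisymm
  · intro F hF
    obtain ⟨a, ha, rfl⟩ := h.exists_homogeneous_coeff hF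
    refine Submodule.sum_mem _ fun j _ => ?_
    have haj := ha j
    unfold shiftedInvDegree at haj
    split_ifs at haj with hd
    · have hs := invDegree_le_span _ haj
      clear haj
      generalize a j = p at hs
      induction hs using Submodule.span_induction with
      | mem p hp =>
        obtain ⟨α, β, hαβ, rfl⟩ := hp
        exact Submodule.subset_span ⟨α, β, j, by omega, rfl⟩
      | zero => rw [zero_smul]; exact Submodule.zero_mem _
      | add p q _ _ hp hq => rw [add_smul]; exact Submodule.add_mem _ hp hq
      | smul c p _ hp => rw [smul_assoc]; exact Submodule.smul_mem _ c hp
    · rw [(Submodule.mem_bot ℂ).1 haj, zero_smul]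
      exact Submodule.zero_mem _
  · rw [Submodule.span_le]
    rintro _ ⟨α, β, j, rfl, rfl⟩
    rw [add_assoc]
    exact smul_mem_covDegree (polyTheta_pow_mul_polyPhi_pow_mem_invDegree α β) (h.mem j)
      (h.homogeneous j)

/-- A homogeneous basis as a basis of the module of covariants. -/
def basis (h : IsHomogeneousBasis ρ d v) : Module.Basis (Fin n) invRing (covModule ρ) :=
  (Module.Basis.span h.linearIndependent).map (LinearEquiv.ofEq _ _ h.span_eq)

end IsHomogeneousBasis

/-! ### The Hilbert series -/

/-- Multiplication by 1 - X²⁴ takes differences of the floor function and leaves the indicator of d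
+ 8ℕ; multiplication by 1 - X⁸ then telescopes it to X^d. -/
lemma mk_div_mul (d : ℕ) : (PowerSeries.mk fun k =>
      (if d ≤ k ∧ (k - d) % 8 = 0 then ((k - d) / 24 + 1 : ℕ) else 0 : ℤ)) *
        ((1 - PowerSeries.X ^ 8) * (1 - PowerSeries.X ^ 24)) = PowerSeries.X ^ d := by
  have h24 : (PowerSeries.mk fun k =>
      (if d ≤ k ∧ (k - d) % 8 = 0 then ((k - d) / 24 + 1 : ℕ) else 0 : ℤ)) *
        (1 - PowerSeries.X ^ 24) =
      PowerSeries.mk fun k => (if d ≤ k ∧ (k - d) % 8 = 0 then 1 else 0 : ℤ) := by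
    ext k
    rw [mul_sub, mul_one, map_sub, PowerSeries.coeff_mul_X_pow', PowerSeries.coeff_mk,
      PowerSeries.coeff_mk, PowerSeries.coeff_mk]
    split_ifs <;> omega
  rw [mul_comm (1 - PowerSeries.X ^ 8), ← mul_assoc, h24]
  ext k
  rw [mul_sub, mul_one, map_sub, PowerSeries.coeff_mul_X_pow', PowerSeries.coeff_mk,
    PowerSeries.coeff_mk, PowerSeries.coeff_X_pow]
  split_ifs <;> omega

lemma hilbertSeries_mul {m : ℕ} {ρ : grp →* GL (Fin m) ℂ} {e : ℕ}
    (h : ∀ k, Module.finrank ℂ (covDegree ρ k) =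
      ∑ j : Fin 3, if e + 8 * (j : ℕ) ≤ k ∧ (k - (e + 8 * (j : ℕ))) % 8 = 0 then
        (k - (e + 8 * (j : ℕ))) / 24 + 1 else 0) :
    hilbertSeries ρ * ((1 - PowerSeries.X ^ 8) * (1 - PowerSeries.X ^ 24)) =
      PowerSeries.X ^ e + PowerSeries.X ^ (e + 8) + PowerSeries.X ^ (e + 16) := by
  rw [← mk_div_mul e, ← mk_div_mul (e + 8), ← mk_div_mul (e + 16), ← add_mul, ← add_mul]
  congr 1
  ext k
  simp only [hilbertSeries, map_add, PowerSeries.coeff_mk, h, Fin.sum_univ_three]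
  push_cast
  rfl

/-- In degree e + 8n the three floor terms add up to n + 1. Truncation at e + 33 keeps the degrees
up to e + 32, the fifth term. -/
lemma trunc_hilbertSeries {m : ℕ} {ρ : grp →* GL (Fin m) ℂ} {e : ℕ}
    (h : ∀ k, Module.finrank ℂ (covDegree ρ k) =
      ∑ j : Fin 3, if e + 8 * (j : ℕ) ≤ k ∧ (k - (e + 8 * (j : ℕ))) % 8 = 0 then
        (k - (e + 8 * (j : ℕ))) / 24 + 1 else 0) :
    PowerSeries.trunc (e + 33) (hilbertSeries ρ) =
      ∑ n ∈ Finset.range 5, ((n : Polynomial ℤ) + 1) * Polynomial.X ^ (e + 8 * n) := by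
  ext k
  have hc : ∀ n : ℕ, (((n : Polynomial ℤ) + 1) * Polynomial.X ^ (e + 8 * n)).coeff k =
      if k = e + 8 * n then (n : ℤ) + 1 else 0 := fun n => by
    rw [show (n : Polynomial ℤ) + 1 = Polynomial.C ((n : ℤ) + 1) by simp,
      Polynomial.coeff_C_mul_X_pow]
  rw [PowerSeries.coeff_trunc, Polynomial.finsetSum_coeff, Finset.sum_congr rfl fun n _ => hc n]
  simp only [hilbertSeries, PowerSeries.coeff_mk, h, Fin.sum_univ_three, Fin.val_zero,
    Fin.val_one, Fin.val_two, Finset.sum_range_succ, Finset.sum_range_zero]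
  push_cast
  split_ifs <;> omega

/-! ### The involution -/

/-- D² = diag(1, -1), and conjugation by T turns it into the permutation matrix. -/
lemma swapXY_eq_act : swapXY = act (matT * matD * matD * matT) := by
  have h : matT * matD * matD * matT = !![0, 1; 1, 0] := by
    have h := sqrt_two_inv_sq
    have hI := Complex.I_sq
    generalize hs : ((Real.sqrt 2 : ℝ) : ℂ)⁻¹ = s at *
    rw [matT, hs, matD]
    generalize Complex.I = u at *
    ext i j
    fin_cases i <;> fin_cases j <;> simp
    · linear_combination s ^ 2 * hI
    · linear_combination 2 * h - s ^ 2 * hI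
    · linear_combination 2 * h - s ^ 2 * hI
    · linear_combination s ^ 2 * hI
  rw [h]
  refine algHom_ext fun i => ?_
  fin_cases i <;> simp [swapXY, act]

/-- ρ₂₁(T D² T) reverses the order of the coordinates, and the twist contributes a²(iⁿ)² = (-1)ⁿ. -/
lemma SymCov.swapXY_apply {a : ℂ} {n : ℕ} {F : Fin 3 → Poly} (ha : a ^ 2 = 1)
    (h : SymCov a (Complex.I ^ n) F) (r : Fin 3) :
    swapXY (F r) = (-1) ^ n * F (Fin.rev r) := by
  obtain ⟨h0, h1, h2, h3, h4, h5⟩ := h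
  have h40 : (4 : Poly) ≠ 0 := by
    rw [← map_ofNat (C : ℂ →+* Poly)]; exact C_ne_zero.2 (by norm_num)
  have haC : (C a : Poly) ^ 2 = 1 := by rw [← map_pow, ha, C_1]
  have hIC := C_I_sq
  rw [C_mul] at h4
  rw [C_neg] at h5
  have hb : (C (Complex.I ^ n) : Poly) ^ 2 = (-1) ^ n := by
    rw [← map_pow, ← pow_mul, mul_comm n 2, pow_mul, Complex.I_sq]; simp
  rw [← hb, swapXY_eq_act, ← act_act, ← act_act, ← act_act]
  -- The innermost T is expanded first. Each of the two uses of T brings a factor 2, hence the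
  -- multiplication by 4 below.
  have H0 := congrArg (fun p => act matT (act matD (act matD p))) h0
  have H1 := congrArg (fun p => act matT (act matD (act matD p))) h1
  have H2 := congrArg (fun p => act matT (act matD (act matD p))) h2
  simp only [map_mul, map_add, map_sub, map_neg, map_ofNat, act_C, h3, h4, h5] at H0 H1 H2
  refine mul_left_cancel₀ h40 ?_
  generalize (C (Complex.I ^ n) : Poly) = b at *
  generalize (C a : Poly) = a at *
  fin_cases r
  · change 4 * act matT (act matD (act matD (act matT (F 0)))) = 4 * (b ^ 2 * F 2)
    linear_combination 2 * H0 + a * b ^ 2 * (h0 + 2 * C Complex.I ^ 2 * h1 + h2) +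
      2 * a ^ 2 * b ^ 2 * (F 0 - F 2) * hIC + 4 * b ^ 2 * F 2 * haC
  · change 4 * act matT (act matD (act matD (act matT (F 1)))) = 4 * (b ^ 2 * F 1)
    linear_combination 2 * H1 + a * b ^ 2 * (h0 - h2) + 4 * b ^ 2 * F 1 * haC
  · change 4 * act matT (act matD (act matD (act matT (F 2)))) = 4 * (b ^ 2 * F 0)
    linear_combination 2 * H2 + a * b ^ 2 * (h0 - 2 * C Complex.I ^ 2 * h1 + h2) -
      2 * a ^ 2 * b ^ 2 * (F 0 - F 2) * hIC + 4 * b ^ 2 * F 0 * haC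

lemma IsHomogeneousBasis.swapXY_apply {i : ℕ} (hi : 21 ≤ i) (hi' : i ≤ 28) {d : Fin 3 → ℕ}
    {v : Fin 3 → Fin 3 → Poly} (h : IsHomogeneousBasis (rho i) d v) (j r : Fin 3) :
    swapXY (v j r) = (-1) ^ expD i * v j (Fin.rev r) := by
  refine ((mem_covModule_rho_iff_symCov hi hi').1 (h.mem j)).swapXY_apply ?_ r
  unfold signT
  split_ifs <;> norm_num

end

end G9

/-! ### The main theorem -/

open G9 MvPolynomial in
theorem mainTheorem4 (i : ℕ) (hi : 21 ≤ i) (hi' : i ≤ 28) :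
    -- freeness of rank three
    Module.Free invRing (covModule (rho i)) ∧
    Module.finrank invRing (covModule (rho i)) = 3 ∧
    -- the Hilbert series, and its first five terms
    (∀ k, Module.Finite ℂ (covDegree (rho i) k)) ∧
    hilbertSeries (rho i) * ((1 - PowerSeries.X ^ 8) * (1 - PowerSeries.X ^ 24)) =
      PowerSeries.X ^ degTable i + PowerSeries.X ^ (degTable i + 8)
        + PowerSeries.X ^ (degTable i + 16) ∧
    PowerSeries.trunc (degTable i + 33) (hilbertSeries (rho i)) =
      ∑ n ∈ Finset.range 5, ((n : Polynomial ℤ) + 1) * Polynomial.X ^ (degTable i + 8 * n) ∧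
    -- there is a homogeneous basis in the stated degrees, with the stated determinant
    (∃ v : Fin 3 → Fin 3 → Poly, IsHomogeneousBasis (rho i) (genDegree i) v ∧
      colDet v = C (cTable i) * polyDelta ^ eTable i * polyGamma ^ kTable i) ∧
    -- properties of every homogeneous basis in these degrees
    (∀ v : Fin 3 → Fin 3 → Poly, IsHomogeneousBasis (rho i) (genDegree i) v →
      (∀ d : ℕ, covDegree (rho i) d = Submodule.span ℂ
        {F | ∃ (α β : ℕ) (j : Fin 3), d = genDegree i j + 8 * α + 24 * β ∧
          F = (polyTheta ^ α * polyPhi ^ β) • v j}) ∧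
      (∃ c : ℂ, c ≠ 0 ∧ colDet v = C c * polyDelta ^ eTable i * polyGamma ^ kTable i) ∧
      (colDet v).totalDegree = ∑ j, genDegree i j ∧
      ∑ j, genDegree i j = 12 * eTable i + 6 * kTable i ∧
      (i ∈ ({21, 22, 25, 26} : Set ℕ) → ∀ j, ∃ f g : Poly,
        f.IsHomogeneous (genDegree i j) ∧ g.IsHomogeneous (genDegree i j) ∧
        v j = ![f, g, swapXY f] ∧ swapXY g = g) ∧
      (i ∈ ({23, 24, 27, 28} : Set ℕ) → ∀ j, ∃ f g : Poly,
        f.IsHomogeneous (genDegree i j) ∧ g.IsHomogeneous (genDegree i j) ∧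
        v j = ![f, g, -swapXY f] ∧ swapXY g = -g)) := by
  -- Freeness, rank and dimensions do not depend on the constant of the determinant, so the basis
  -- with constant 1 serves here.
  obtain ⟨v₀, hv₀, -⟩ := exists_isHomogeneousBasis hi hi' one_ne_zero
  have hrank := hv₀.finrank_covDegree
  have hc : cTable i ≠ 0 := by interval_cases i <;> norm_num [cTable]
  have hsum : ∑ j, genDegree i j = 12 * eTable i + 6 * kTable i := by
    interval_cases i <;> rfl
  refine ⟨Module.Free.of_basis hv₀.basis, ?_, hv₀.finite_covDegree, hilbertSeries_mul hrank,
    trunc_hilbertSeries hrank, exists_isHomogeneousBasis hi hi' hc, fun v hv => ?_⟩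
  · rw [Module.finrank_eq_card_basis hv₀.basis, Fintype.card_fin]
  have hswap := hv.swapXY_apply hi hi'
  obtain ⟨c, hc0, hdet⟩ := hv.exists_colDet_eq hi hi'
  refine ⟨hv.covDegree_eq_span, ⟨c, hc0, hdet⟩, ?_, hsum, fun hmem j => ?_, fun hmem j => ?_⟩
  · rw [hsum, hdet]
    refine IsHomogeneous.totalDegree ?_ (polyDelta_mul_polyGamma_ne_zero hc0 _ _)
    exact ((isHomogeneous_polyDelta.pow _).C_mul c).mul (isHomogeneous_polyGamma.pow _)
  -- The sign is the parity of the D-exponent n, which is 0 or 2 in these four cases and 1 or 3 in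
  -- the others.
  · have hs : (-1 : Poly) ^ expD i = 1 := by
      rcases hmem with rfl | rfl | rfl | rfl <;> norm_num [expD]
    rw [hs] at hswap
    refine ⟨v j 0, v j 1, hv.homogeneous j 0, hv.homogeneous j 1, ?_, ?_⟩
    · funext r
      fin_cases r
      · rfl
      · rfl
      · exact (one_mul (v j 2)).symm.trans (hswap j 0).symm
    · exact (hswap j 1).trans (one_mul _)
  · have hs : (-1 : Poly) ^ expD i = -1 := by
      rcases hmem with rfl | rfl | rfl | rfl <;> norm_num [expD]
    rw [hs] at hswap
    refine ⟨v j 0, v j 1, hv.homogeneous j 0, hv.homogeneous j 1, ?_, ?_⟩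
    · funext r
      fin_cases r
      · rfl
      · rfl
      · change v j 2 = -swapXY (v j 0)
        rw [hswap j 0, neg_one_mul, neg_neg]
        rfl
    · exact (hswap j 1).trans (neg_one_mul _)
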